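/- Let $T$ be a bounded linear operator on a complex Banach space $X$, let $K\subset\mathbb{C}$ be a compact set containing the spectrum $\sigma(T)$, and let $s\ge 1$ be a real number. We say that $T$ has resolvent growth of order $s$ near $K$ if there are an open disc $D(a,R)$ containing $K$ and a constant $C$ such that $$\|(T-\lambda)^{-1}\|\le C\,\operatorname{dist}(\lambda,K)^{-s}\qquad\text{for all }\lambda\in D(a,R)\setminus K.$$ Let $\Omega\subset\mathbb{C}$ be an open set containing $K$, and let $f:\Omega\to\mathbb{C}$ be an analytic function that is not constant on any connected component of $\Omega$. Let $f(T)$ be defined by the Riesz--Dunford calculus, $$f(T)=\frac1{2\pi i}\int_\Gamma f(z)(z-T)^{-1}\,dz,$$ where $\Gamma$ is any cycle (a finite family of piecewise $C^1$ closed curves) in $\Omega\setminus\sigma(T)$ with winding number $1$ about each point of $\sigma(T)$ and $0$ about each point of $\mathbb{C}\setminus\Omega$. **Theorem A (Bakaev).** If $T$ has resolvent growth of order $s$ near $K$, then $f(T)$ has resolvent growth of order $s$ near $f(K)$; in particular, $\sigma(f(T))\subset f(K)$. (Zeros of $f'$ on $K$ are allowed.) -/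

import Mathlib

noncomputable section

/-- `T` has resolvent growth of order `s` near `K`: the set `K` is compact and contains `σ(T)`, and
`‖(T - z)⁻¹‖ ≤ C dist(z, K)^(-s)` for all `z` outside `K` in some open disc containing `K`.
(Mathlib's `resolvent T z` is `(z - T)⁻¹`, which has the same norm as `(T - z)⁻¹`.) -/
def HasResolventGrowth {X : Type*} [NormedAddCommGroup X] [NormedSpace ℂ X]
    (T : X →L[ℂ] X) (K : Set ℂ) (s : ℝ) : Prop :=
  IsCompact K ∧ spectrum ℂ T ⊆ K ∧
    ∃ (a : ℂ) (R C : ℝ), K ⊆ Metric.ball a R ∧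
      ∀ z ∈ Metric.ball a R \ K, ‖resolvent T z‖ ≤ C * Metric.infDist z K ^ (-s)

/-- A cycle in the plane: finitely many `C¹` arcs, parametrized by `[0, 1]`, such that every point
is as often an initial point as a terminal point of an arc (counted with multiplicity). For
instance, a finite family of piecewise `C¹` closed curves, cut at the break points. -/
structure PlaneCycle where
  /-- the number of arcs -/
  n : ℕ
  /-- the arcs, of which only the values on `[0, 1]` matter -/
  arc : Fin n → ℝ → ℂ
  contDiffOn_arc : ∀ i, ContDiffOn ℝ 1 (arc i) (Set.Icc 0 1)
  boundary_eq_zero :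
    (Finset.univ : Finset (Fin n)).val.map (fun i => arc i 0) =
      (Finset.univ : Finset (Fin n)).val.map (fun i => arc i 1)

namespace PlaneCycle

/-- The set of points lying on the cycle. -/
def trace (Γ : PlaneCycle) : Set ℂ :=
  ⋃ i, Γ.arc i '' Set.Icc 0 1

/-- The contour integral `∫_Γ F(z) dz` of a vector-valued function. -/
def integral {E : Type*} [NormedAddCommGroup E] [NormedSpace ℂ E] (Γ : PlaneCycle) (F : ℂ → E) :
    E :=
  ∑ i, ∫ t in (0 : ℝ)..1, derivWithin (Γ.arc i) (Set.Icc 0 1) t • F (Γ.arc i t)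

/-- The winding number of the cycle about a point `w` that is not on it. -/
def windingNumber (Γ : PlaneCycle) (w : ℂ) : ℂ :=
  (2 * (Real.pi : ℂ) * Complex.I)⁻¹ * Γ.integral (fun z => (z - w)⁻¹)

/-- `Γ` is a cycle in `Ω \ S` that surrounds `S` once in the positive sense inside `Ω`: it winds
once around each point of `S` and zero times around each point outside `Ω`. -/
def Surrounds (Γ : PlaneCycle) (S Ω : Set ℂ) : Prop :=
  Γ.trace ⊆ Ω \ S ∧ (∀ w ∈ S, Γ.windingNumber w = 1) ∧ ∀ w ∉ Ω, Γ.windingNumber w = 0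

end PlaneCycle

/-- The Riesz–Dunford integral `f(T) = (2πi)⁻¹ ∫_Γ f(z) (z - T)⁻¹ dz`. -/
def rieszDunford {X : Type*} [NormedAddCommGroup X] [NormedSpace ℂ X]
    (f : ℂ → ℂ) (T : X →L[ℂ] X) (Γ : PlaneCycle) : X →L[ℂ] X :=
  (2 * (Real.pi : ℂ) * Complex.I)⁻¹ • Γ.integral (fun z => f z • resolvent T z)

end

/-! Fix `b ∉ f(K)` in a disc containing `f(K)` and put `D = dist(b, f(K))`. Near `K` the function
`1/(f - b)` has finitely many poles `ζ`, the roots of `f = b`. If all are simple, `1/(f - b) = q + ∑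
1/(f'(ζ)(z - ζ))` with `q` holomorphic, and therefore `(f(T) - b)⁻¹ = q(T) + ∑ f'(ζ)⁻¹ (T - ζ)⁻¹`.

Everything rests on the inequality `dist(f(z), f(K)) ≤ C |f'(z)| dist(z, K)` near `K`
(`exists_infDist_image_le`), which survives zeros of `f'` on `K`. At a root `ζ` with `d = dist(ζ,
K)` it reads `D ≤ C |f'(ζ)| d`. So the roots are simple, `|f'(ζ)|⁻¹ ≤ C d / D`, and `D ≤ C' d`
because `f'` is bounded. Each pole term is then at most a constant times `(d / D) d^(-s) = d^(1-s) /
D`, which is `O(D^(-s))` since `s ≥ 1`. The number of roots is bounded uniformly in `b`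
(`exists_card_le_of_isCompact`), and `q = O(1/D)` by the maximum principle on circles where `|f -
b|` is bounded below (`exists_sphere_le_norm_sub`). As `D` is bounded, `1/D = O(D^(-s))`.

The calculus is handled through area integrals: by the Cauchy–Pompeiu formula a contour integral
becomes an integral against `∂̄χ` for a cutoff `χ`. Cutoffs exist around any compact set, so no
further cycle has to be constructed, and multiplicativity follows from Fubini. -/

noncomputable section

open Complex MeasureTheory Set Filter Topology

/-! ### The Cauchy–Pompeiu formula -/

section CauchyPompeiuFormula

variable {E : Type*} [NormedAddCommGroup E] [NormedSpace ℂ E]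

/-- The Wirtinger derivative `∂u/∂z̄`. -/
def dbar (u : ℂ → E) (z : ℂ) : E :=
  (2⁻¹ : ℂ) • (fderiv ℝ u z 1 + I • fderiv ℝ u z I)

theorem Filter.EventuallyEq.dbar_eq {u v : ℂ → E} {z : ℂ} (h : u =ᶠ[𝓝 z] v) :
    dbar u z = dbar v z := by
  simp only [dbar, h.fderiv_eq]

theorem dbar_eq_zero_of_eventuallyEq_const {u : ℂ → E} {z : ℂ} {c : E}
    (h : u =ᶠ[𝓝 z] fun _ => c) : dbar u z = 0 := by
  rw [h.dbar_eq]; simp [dbar]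

theorem tsupport_dbar_subset (u : ℂ → E) : tsupport (dbar u) ⊆ tsupport u := by
  refine closure_minimal (fun z hz => ?_) (isClosed_tsupport u)
  by_contra h
  exact hz (dbar_eq_zero_of_eventuallyEq_const (c := 0) (notMem_tsupport_iff_eventuallyEq.1 h))

theorem dbar_eq_zero_of_notMem_tsupport {u : ℂ → E} {z : ℂ} (h : z ∉ tsupport u) :
    dbar u z = 0 :=
  dbar_eq_zero_of_eventuallyEq_const (c := 0) (notMem_tsupport_iff_eventuallyEq.1 h)

theorem HasCompactSupport.dbar {u : ℂ → E} (h : HasCompactSupport u) :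
    HasCompactSupport (dbar u) :=
  h.mono' ((subset_tsupport _).trans (tsupport_dbar_subset u))

theorem ContDiff.continuous_dbar {u : ℂ → E} (hu : ContDiff ℝ 1 u) : Continuous (dbar u) := by
  have h := hu.continuous_fderiv one_ne_zero
  unfold _root_.dbar
  fun_prop

theorem dbar_smul {χ : ℂ → ℂ} {F : ℂ → E} {z : ℂ} (hχ : DifferentiableAt ℝ χ z)
    (hF : DifferentiableAt ℂ F z) : dbar (fun w => χ w • F w) z = dbar χ z • F z := by
  have h1 := hF.hasFDerivAt.restrictScalars ℝ
  have h2 := (hχ.hasFDerivAt.smul h1).fderiv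
  have h3 : fderiv ℂ F z I = I • fderiv ℂ F z 1 := by
    rw [← map_smul]; simp
  have h4 : fderiv ℝ (fun w => χ w • F w) z = _ := h2
  simp only [dbar, h4, add_apply, smul_apply,
    ContinuousLinearMap.coe_restrictScalars', ContinuousLinearMap.smulRight_apply, h3]
  match_scalars
  · linear_combination (2⁻¹ * χ z) * I_mul_I
  · ring

theorem dbar_holomorphic_smul {h : ℂ → ℂ} {u : ℂ → E} {z : ℂ} (hh : DifferentiableAt ℂ h z)
    (hu : DifferentiableAt ℝ u z) : dbar (fun w => h w • u w) z = h z • dbar u z := by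
  have h1 := hh.hasFDerivAt.restrictScalars ℝ
  have h2 := (h1.smul hu.hasFDerivAt).fderiv
  have h3 : fderiv ℂ h z I = I * fderiv ℂ h z 1 := by
    rw [← smul_eq_mul, ← map_smul]; simp
  have h4 : fderiv ℝ (fun w => h w • u w) z = _ := h2
  simp only [dbar, h4, add_apply, smul_apply,
    ContinuousLinearMap.coe_restrictScalars', ContinuousLinearMap.smulRight_apply, h3]
  match_scalars
  · ring
  · linear_combination (2⁻¹ * (fderiv ℂ h z) 1) * I_mul_I
  · ring

/-- The left side is twice the conjugate-linear part of `L`. With `v = e^{iθ}` this expresses `∂̄u`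
through the radial and angular derivatives. -/
theorem dbar_real_linear (L : ℂ →L[ℝ] E) (v : ℂ) :
    L v + I • L (I * v) = (starRingEnd ℂ v) • (L 1 + I • L I) := by
  have h1 : L v = v.re • L 1 + v.im • L I := by
    rw [← L.map_smul, ← L.map_smul, ← L.map_add]; congr 1
    apply Complex.ext <;> simp
  have h2 : L (I * v) = (-v.im) • L 1 + v.re • L I := by
    rw [← L.map_smul, ← L.map_smul, ← L.map_add]; congr 1
    apply Complex.ext <;> simp
  rw [h1, h2]
  have h3 : starRingEnd ℂ v = (v.re : ℂ) - v.im * I := by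
    apply Complex.ext <;> simp
  rw [h3]
  simp only [← Complex.coe_smul]
  match_scalars
  · ring
  · linear_combination (v.im : ℂ) * I_mul_I

theorem dbar_smul_of_tsupport_subset {χ : ℂ → ℂ} {F : ℂ → E} {U : Set ℂ} (hU : IsOpen U)
    (hχ : ContDiff ℝ 1 χ) (hs : tsupport χ ⊆ U) (hF : DifferentiableOn ℂ F U) (z : ℂ) :
    dbar (fun w => χ w • F w) z = dbar χ z • F z := by
  by_cases hz : z ∈ tsupport χ
  · exact dbar_smul (hχ.differentiable one_ne_zero z) (hF.differentiableAt (hU.mem_nhds (hs hz)))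
  · rw [dbar_eq_zero_of_notMem_tsupport hz, zero_smul]
    refine dbar_eq_zero_of_eventuallyEq_const (c := 0) ?_
    filter_upwards [notMem_tsupport_iff_eventuallyEq.1 hz] with w hw
    simp [hw]

section CauchyPompeiu

variable [CompleteSpace E]

/-- In polar coordinates the Jacobian `r` cancels `|w|⁻¹`, and the integrand becomes `(A + iB)/2`
with `A = ∂u/∂r` and `B = r⁻¹ ∂u/∂θ`. Over each circle `B` integrates to `0` by periodicity; along
each ray `A` integrates to `-u(0)`. Hence the total is `2π · (-u(0)) / 2`. -/
theorem integral_inv_smul_dbar {u : ℂ → E} (hu : ContDiff ℝ 1 u) (hc : HasCompactSupport u) :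
    ∫ w, w⁻¹ • dbar u w = -(Real.pi : ℂ) • u 0 := by
  obtain ⟨ρ, hρ0, hρ⟩ : ∃ ρ : ℝ, 0 < ρ ∧ ∀ w : ℂ, ρ ≤ ‖w‖ → w ∉ tsupport u := by
    obtain ⟨ρ, h⟩ := hc.isCompact.isBounded.subset_ball (0 : ℂ)
    refine ⟨max ρ 1, by positivity, fun w hw hm => ?_⟩
    have := h hm
    simp at this
    linarith [le_max_left ρ 1]
  have hD := hu.continuous_fderiv one_ne_zero
  have hdiff : Differentiable ℝ u := hu.differentiable one_ne_zero
  set e : ℝ → ℂ := fun θ => exp (θ * I) with he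
  have hec : Continuous e := by fun_prop
  have hen : ∀ θ, ‖e θ‖ = 1 := fun θ => norm_exp_ofReal_mul_I θ
  set A : ℝ × ℝ → E := fun p => fderiv ℝ u (p.1 * e p.2) (e p.2) with hA
  set B : ℝ × ℝ → E := fun p => fderiv ℝ u (p.1 * e p.2) (I * e p.2) with hB
  have hAc : Continuous A := by fun_prop
  have hBc : Continuous B := by fun_prop
  set S : Set (ℝ × ℝ) := Ioc 0 ρ ×ˢ Ioo (-Real.pi) Real.pi with hS
  have hSK : S ⊆ Icc 0 ρ ×ˢ Icc (-Real.pi) Real.pi :=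
    prod_mono Ioc_subset_Icc_self Ioo_subset_Icc_self
  have hKc : IsCompact (Icc (0:ℝ) ρ ×ˢ Icc (-Real.pi) Real.pi) := isCompact_Icc.prod isCompact_Icc
  have hAi : IntegrableOn A S := (hAc.continuousOn.integrableOn_compact hKc).mono_set hSK
  have hBi : IntegrableOn B S := (hBc.continuousOn.integrableOn_compact hKc).mono_set hSK
  have key : ∀ p ∈ polarCoord.target, p.1 • ((Complex.polarCoord.symm p)⁻¹ •
      dbar u (Complex.polarCoord.symm p)) = (2⁻¹ : ℂ) • (A p + I • B p) := by
    rintro ⟨r, θ⟩ hp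
    have hr : 0 < r := by simpa using hp.1
    have h1 : Complex.polarCoord.symm (r, θ) = r * e θ := by
      simp [he, Complex.polarCoord_symm_apply, exp_mul_I]
    have h2 : starRingEnd ℂ (e θ) = (e θ)⁻¹ := by
      rw [Complex.inv_def, normSq_eq_norm_sq, hen]; simp
    rw [h1]
    simp only [hA, hB, dbar_real_linear, h2, dbar]
    rw [← Complex.coe_smul, smul_smul, smul_smul, smul_smul]
    congr 1
    have : e θ ≠ 0 := exp_ne_zero _
    have : (r : ℂ) ≠ 0 := by exact_mod_cast hr.ne'
    field_simp
  rw [← Complex.integral_comp_polarCoord_symm]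
  have hmeas : MeasurableSet polarCoord.target := polarCoord.open_target.measurableSet
  rw [setIntegral_congr_fun hmeas key]
  have hzero : ∀ p : ℝ × ℝ, ρ ≤ p.1 → fderiv ℝ u (p.1 * e p.2) = 0 := by
    intro p hp
    have : (p.1 : ℂ) * e p.2 ∉ tsupport u := by
      apply hρ
      rw [norm_mul, hen, mul_one, Complex.norm_real]
      exact hp.trans (le_abs_self _)
    rw [(notMem_tsupport_iff_eventuallyEq.1 this).fderiv_eq]
    simp
  rw [setIntegral_eq_of_subset_of_forall_sdiff_eq_zero (t := polarCoord.target) (s := S) hmeas]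
  rotate_left
  · rintro ⟨r, θ⟩ ⟨h1, h2⟩
    rw [polarCoord_target]
    exact ⟨h1.1, h2⟩
  · rintro ⟨r, θ⟩ ⟨h1, h2⟩
    rw [polarCoord_target] at h1
    have : ρ ≤ r := by
      by_contra h
      exact h2 ⟨⟨h1.1, (not_le.1 h).le⟩, h1.2⟩
    simp [hA, hB, hzero (r, θ) this]
  have hBi' : Integrable (fun p => I • B p) (volume.restrict S) := hBi.smul I
  rw [integral_smul, integral_add hAi hBi', integral_smul]
  have hIB : ∫ p in S, B p = 0 := by
    rw [hS, Measure.volume_eq_prod, setIntegral_prod _ hBi]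
    rw [setIntegral_congr_fun (g := fun _ => (0 : E)) measurableSet_Ioc]
    · simp
    intro r hr
    have hr0 : r ≠ 0 := hr.1.ne'
    have : ∀ θ ∈ uIcc (-Real.pi) Real.pi,
        HasDerivAt (fun θ : ℝ => r⁻¹ • u (r * e θ)) (B (r, θ)) θ := by
      intro θ _
      have h1 : HasDerivAt e (I * e θ) θ := by
        have : HasDerivAt (fun θ : ℝ => (θ : ℂ) * I) (1 * I) θ :=
          (Complex.ofRealCLM.hasDerivAt (x := θ)).mul_const I
        have := this.cexp
        simpa [he, mul_comm] using this
      have h2 := ((hdiff (r * e θ)).hasFDerivAt.comp_hasDerivAt θ (h1.const_mul (r : ℂ))).const_smul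
        r⁻¹
      have h5 : B (r, θ) = r⁻¹ • fderiv ℝ u (r * e θ) (r * (I * e θ)) := by
        rw [hB, ← map_smul]
        simp only
        congr 1
        rw [Complex.real_smul]
        push_cast
        have : (r : ℂ) ≠ 0 := by exact_mod_cast hr0
        field_simp
      rw [h5]
      exact h2
    have h3 := intervalIntegral.integral_eq_sub_of_hasDerivAt this
      ((hBc.comp (by fun_prop : Continuous fun θ : ℝ => (r, θ))).intervalIntegrable _ _)
    simp only
    rw [← integral_Ioc_eq_integral_Ioo, ← intervalIntegral.integral_of_le (by linarith [Real.pi_pos]), h3]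
    simp [he, exp_neg]
  have hIA : ∫ p in S, A p = -(2 * Real.pi) • u 0 := by
    rw [hS, Measure.volume_eq_prod, setIntegral_prod _ hAi]
    have hAi' := hAi
    rw [IntegrableOn, Measure.volume_eq_prod, hS, ← Measure.prod_restrict] at hAi'
    rw [integral_integral_swap hAi']
    rw [setIntegral_congr_fun (g := fun _ => -u 0) measurableSet_Ioo]
    · rw [setIntegral_const, smul_neg, neg_smul, measureReal_def, Real.volume_Ioo,
        ENNReal.toReal_ofReal (by linarith [Real.pi_pos]), sub_neg_eq_add, two_mul]
    intro θ _
    have : ∀ r ∈ uIcc 0 ρ, HasDerivAt (fun r : ℝ => u (r * e θ)) (A (r, θ)) r := by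
      intro r _
      have h1 : HasDerivAt (fun r : ℝ => (r : ℂ) * e θ) (1 * e θ) r :=
          (Complex.ofRealCLM.hasDerivAt (x := r)).mul_const _
      rw [one_mul] at h1
      exact (hdiff (r * e θ)).hasFDerivAt.comp_hasDerivAt r h1
    have h3 := intervalIntegral.integral_eq_sub_of_hasDerivAt this
      ((hAc.comp (by fun_prop : Continuous fun r : ℝ => (r, θ))).intervalIntegrable _ _)
    simp only
    rw [← intervalIntegral.integral_of_le hρ0.le, h3]
    have : u (ρ * e θ) = 0 := image_eq_zero_of_notMem_tsupport (hρ _ (by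
      rw [norm_mul, hen, mul_one, Complex.norm_real]; exact le_abs_self _))
    simp [this]
  rw [hIA, hIB, smul_zero, add_zero, ← Complex.coe_smul, smul_smul]
  congr 1
  push_cast; ring

/-- The Cauchy–Pompeiu formula for compactly supported functions. -/
theorem integral_sub_inv_smul_dbar {u : ℂ → E} (hu : ContDiff ℝ 1 u) (hc : HasCompactSupport u)
    (z : ℂ) : ∫ w, (w - z)⁻¹ • dbar u w = -(Real.pi : ℂ) • u z := by
  have h := integral_inv_smul_dbar (u := fun w => u (w + z)) (hu.comp (by fun_prop))
    (hc.comp_homeomorph (Homeomorph.addRight z))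
  have h2 : ∀ w, dbar (fun w => u (w + z)) w = dbar u (w + z) := by
    intro w
    simp [dbar, fderiv_comp_add_right]
  simp only [h2, zero_add] at h
  rw [← h, ← integral_add_right_eq_self _ z]
  simp

/-- Apply the previous formula to `w u(w)`: this vanishes at `0`, and its `∂̄` is `w ∂̄u`. -/
theorem integral_dbar {u : ℂ → E} (hu : ContDiff ℝ 1 u) (hc : HasCompactSupport u) :
    ∫ w, dbar u w = 0 := by
  have h := integral_inv_smul_dbar (u := fun w => w • u w) (contDiff_id.smul hu)
    (hc.smul_left (f := fun w : ℂ => w))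
  rw [zero_smul, smul_zero] at h
  rw [← h]
  refine integral_congr_ae ?_
  have h0 : ∀ᵐ w : ℂ, w ≠ 0 := by simp [ae_iff]
  filter_upwards [h0] with w hw
  rw [dbar_holomorphic_smul differentiableAt_fun_id (hu.differentiable one_ne_zero w),
    inv_smul_smul₀ hw]

theorem contDiff_smul_of_tsupport_subset {χ : ℂ → ℂ} {F : ℂ → E} {U : Set ℂ} (hU : IsOpen U)
    (hχ : ContDiff ℝ 1 χ) (hs : tsupport χ ⊆ U) (hF : DifferentiableOn ℂ F U) :
    ContDiff ℝ 1 (fun w => χ w • F w) := by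
  refine contDiff_iff_contDiffAt.2 fun z => ?_
  by_cases hz : z ∈ tsupport χ
  · have : AnalyticAt ℂ F z := hF.analyticAt (hU.mem_nhds (hs hz))
    exact hχ.contDiffAt.smul (this.contDiffAt.restrict_scalars ℝ)
  · have h0 : (fun w => χ w • F w) =ᶠ[𝓝 z] fun _ => 0 := by
      filter_upwards [notMem_tsupport_iff_eventuallyEq.1 hz] with w hw
      simp [hw]
    exact contDiffAt_const.congr_of_eventuallyEq h0

theorem integral_dbar_smul_eq_zero {χ : ℂ → ℂ} {F : ℂ → E} {U : Set ℂ} (hU : IsOpen U)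
    (hχ : ContDiff ℝ 1 χ) (hc : HasCompactSupport χ) (hs : tsupport χ ⊆ U)
    (hF : DifferentiableOn ℂ F U) : ∫ w, dbar χ w • F w = 0 := by
  simp only [← dbar_smul_of_tsupport_subset hU hχ hs hF]
  exact integral_dbar (contDiff_smul_of_tsupport_subset hU hχ hs hF) hc.smul_right

/-- The Cauchy–Pompeiu formula for the product of a cutoff and a holomorphic function. -/
theorem integral_sub_inv_dbar_smul {χ : ℂ → ℂ} {F : ℂ → E} {U : Set ℂ} (hU : IsOpen U)
    (hχ : ContDiff ℝ 1 χ) (hc : HasCompactSupport χ) (hs : tsupport χ ⊆ U)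
    (hF : DifferentiableOn ℂ F U) (z : ℂ) :
    ∫ w, (w - z)⁻¹ • dbar χ w • F w = -(Real.pi : ℂ) • χ z • F z := by
  simp only [← dbar_smul_of_tsupport_subset hU hχ hs hF]
  exact integral_sub_inv_smul_dbar (contDiff_smul_of_tsupport_subset hU hχ hs hF) hc.smul_right z

end CauchyPompeiu

end CauchyPompeiuFormula

/-! ### Cycles, winding numbers and contour integrals as area integrals -/

section Cycles

variable {E : Type*} [NormedAddCommGroup E] [NormedSpace ℂ E]

/-- `χ` is a `C¹` function with compact support in `U`, equal to `1` near `S`. -/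
structure IsCutoff (χ : ℂ → ℂ) (S U : Set ℂ) : Prop where
  contDiff : ContDiff ℝ 1 χ
  hasCompactSupport : HasCompactSupport χ
  tsupport_subset : tsupport χ ⊆ U
  eventuallyEq_one : ∀ z ∈ S, χ =ᶠ[𝓝 z] fun _ => 1

namespace IsCutoff

variable {χ : ℂ → ℂ} {S U V : Set ℂ}

theorem mono (h : IsCutoff χ S U) (hUV : U ⊆ V) : IsCutoff χ S V :=
  ⟨h.1, h.2, h.3.trans hUV, h.4⟩

theorem anti {S' : Set ℂ} (h : IsCutoff χ S U) (hS : S' ⊆ S) : IsCutoff χ S' U :=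
  ⟨h.1, h.2, h.3, fun z hz => h.4 z (hS hz)⟩

theorem apply_eq_one (h : IsCutoff χ S U) {z : ℂ} (hz : z ∈ S) : χ z = 1 :=
  (h.4 z hz).self_of_nhds

theorem subset_tsupport (h : IsCutoff χ S U) : S ⊆ tsupport χ := fun z hz =>
  _root_.subset_tsupport _ (by simp [h.apply_eq_one hz])

theorem notMem_tsupport_dbar (h : IsCutoff χ S U) {z : ℂ} (hz : z ∈ S) :
    z ∉ tsupport (dbar χ) := by
  rw [notMem_tsupport_iff_eventuallyEq]
  filter_upwards [(h.4 z hz).eventuallyEq_nhds] with w hw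
  exact dbar_eq_zero_of_eventuallyEq_const hw

end IsCutoff

theorem exists_isCutoff {S U : Set ℂ} (hS : IsCompact S) (hU : IsOpen U) (hSU : S ⊆ U) :
    ∃ χ, IsCutoff χ S U := by
  obtain ⟨V, hV, hSV, hVU, hVc⟩ := exists_open_between_and_isCompact_closure hS hU hSU
  obtain ⟨g, hg0, hg1, -⟩ := exists_contMDiffMap_zero_one_nhds_of_isClosed
    (modelWithCornersSelf ℝ ℂ) (n := 1) hV.isClosed_compl hS.isClosed
    (disjoint_compl_left_iff_subset.2 hSV)
  rw [eventually_nhdsSet_iff_forall] at hg0 hg1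
  have hsupp : tsupport (fun z => (g z : ℂ)) ⊆ V := by
    intro z hz
    by_contra h
    refine notMem_tsupport_iff_eventuallyEq.2 ?_ hz
    filter_upwards [hg0 z h] with w hw
    simp [hw]
  refine ⟨fun z => (g z : ℂ), ?_, ?_, ?_, ?_⟩
  · exact Complex.ofRealCLM.contDiff.comp g.contMDiff.contDiff
  · exact hVc.of_isClosed_subset (isClosed_tsupport _) (hsupp.trans subset_closure)
  · exact hsupp.trans (subset_closure.trans hVU)
  · intro z hz
    filter_upwards [hg1 z hz] with w hw
    simp [hw]

namespace PlaneCycle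

variable (Γ : PlaneCycle)

theorem continuousOn_arc (i : Fin Γ.n) : ContinuousOn (Γ.arc i) (Icc 0 1) :=
  (Γ.contDiffOn_arc i).continuousOn

theorem continuousOn_derivWithin_arc (i : Fin Γ.n) :
    ContinuousOn (derivWithin (Γ.arc i) (Icc 0 1)) (Icc 0 1) :=
  (Γ.contDiffOn_arc i).continuousOn_derivWithin (uniqueDiffOn_Icc zero_lt_one) le_rfl

theorem arc_mem_trace {i : Fin Γ.n} {t : ℝ} (ht : t ∈ Icc (0 : ℝ) 1) : Γ.arc i t ∈ Γ.trace :=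
  mem_iUnion.2 ⟨i, mem_image_of_mem _ ht⟩

theorem isCompact_trace : IsCompact Γ.trace :=
  isCompact_iUnion fun i => isCompact_Icc.image_of_continuousOn (Γ.continuousOn_arc i)

theorem intervalIntegrable {F : ℂ → E} (hF : ContinuousOn F Γ.trace) (i : Fin Γ.n) :
    IntervalIntegrable (fun t => derivWithin (Γ.arc i) (Icc 0 1) t • F (Γ.arc i t)) volume 0 1 := by
  refine ContinuousOn.intervalIntegrable ?_
  rw [uIcc_of_le zero_le_one]
  exact (Γ.continuousOn_derivWithin_arc i).smul
    (hF.comp (Γ.continuousOn_arc i) fun t ht => Γ.arc_mem_trace ht)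

theorem integral_sub {F G : ℂ → E} (hF : ContinuousOn F Γ.trace) (hG : ContinuousOn G Γ.trace) :
    Γ.integral (fun z => F z - G z) = Γ.integral F - Γ.integral G := by
  simp only [integral, smul_sub]
  rw [← Finset.sum_sub_distrib]
  exact Finset.sum_congr rfl fun i _ =>
    intervalIntegral.integral_sub (Γ.intervalIntegrable hF i) (Γ.intervalIntegrable hG i)

/-- The integral of a derivative along a cycle vanishes. -/
theorem integral_eq_zero_of_hasDerivAt [CompleteSpace E] {G F : ℂ → E}
    (hF : ContinuousOn F Γ.trace) (h : ∀ z ∈ Γ.trace, HasDerivAt G (F z) z) :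
    Γ.integral F = 0 := by
  have h1 : ∀ i, ∫ t in (0 : ℝ)..1, derivWithin (Γ.arc i) (Icc 0 1) t • F (Γ.arc i t) =
      G (Γ.arc i 1) - G (Γ.arc i 0) := by
    intro i
    refine intervalIntegral.integral_eq_sub_of_hasDerivAt_of_le zero_le_one ?_ ?_
      (Γ.intervalIntegrable hF i)
      (f := fun t => G (Γ.arc i t))
    · intro t ht
      exact (h _ (Γ.arc_mem_trace ht)).continuousAt.comp_continuousWithinAt
        (Γ.continuousOn_arc i t ht)
    · intro t ht
      have h2 := ((Γ.contDiffOn_arc i).differentiableOn one_ne_zero t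
        (Ioo_subset_Icc_self ht)).hasDerivWithinAt.hasDerivAt (Icc_mem_nhds ht.1 ht.2)
      exact (h _ (Γ.arc_mem_trace (Ioo_subset_Icc_self ht))).scomp t h2
  -- Initial and terminal points agree as multisets, so the endpoint values of `G` cancel in the sum
  -- over the arcs.
  have h2 := congrArg (fun m => (m.map G).sum) Γ.boundary_eq_zero
  simp only [Multiset.map_map, Function.comp_def] at h2
  simp only [integral, h1, Finset.sum_sub_distrib]
  exact sub_eq_zero.2 h2.symm

theorem continuousOn_sub_inv {w : ℂ} (hw : w ∉ Γ.trace) :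
    ContinuousOn (fun z => (z - w)⁻¹) Γ.trace :=
  (by fun_prop : ContinuousOn (fun z => z - w) Γ.trace).inv₀ fun z hz =>
    sub_ne_zero.2 fun h => hw (h ▸ hz)

theorem one_sub_mem_slitPlane {w : ℂ} (h : ‖w‖ < 1) : 1 - w ∈ slitPlane := by
  refine Or.inl ?_
  have := (le_abs_self _).trans (abs_re_le_norm w)
  simp
  linarith

/-- On the cycle `(z - w)/(z - w₀)` lies within distance less than `1` of `1`, so its principal
logarithm is a primitive of the difference of the two Cauchy kernels. -/
theorem windingNumber_eq_of_dist_lt {w w₀ : ℂ} (h : ∀ z ∈ Γ.trace, dist w w₀ < dist z w₀) :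
    Γ.windingNumber w = Γ.windingNumber w₀ := by
  have hw : w ∉ Γ.trace := fun hw => lt_irrefl _ (h w hw)
  have hw₀ : w₀ ∉ Γ.trace := fun hw => by
    have := h w₀ hw
    rw [dist_self] at this
    exact this.not_ge dist_nonneg
  rw [windingNumber, windingNumber]
  congr 1
  rw [← sub_eq_zero, ← Γ.integral_sub (Γ.continuousOn_sub_inv hw) (Γ.continuousOn_sub_inv hw₀)]
  refine Γ.integral_eq_zero_of_hasDerivAt (G := fun z => log (1 - (w - w₀) / (z - w₀)))
    ((Γ.continuousOn_sub_inv hw).sub (Γ.continuousOn_sub_inv hw₀)) fun z hz => ?_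
  have h1 : z - w₀ ≠ 0 := sub_ne_zero.2 fun e => hw₀ (e ▸ hz)
  have h2 : z - w ≠ 0 := sub_ne_zero.2 fun e => hw (e ▸ hz)
  have h3 : 1 - (w - w₀) / (z - w₀) ∈ slitPlane := by
    apply one_sub_mem_slitPlane
    rw [norm_div, ← dist_eq_norm, ← dist_eq_norm]
    exact (div_lt_one (dist_nonneg.trans_lt (h z hz))).2 (h z hz)
  have h4 : HasDerivAt (fun z => 1 - (w - w₀) / (z - w₀)) ((w - w₀) / (z - w₀) ^ 2) z := by
    have := (((hasDerivAt_id z).sub_const w₀).fun_inv h1).const_mul (w - w₀) |>.const_sub 1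
    exact this.congr_deriv (by simp only [id]; ring)
  refine (h4.clog h3).congr_deriv ?_
  rw [show 1 - (w - w₀) / (z - w₀) = (z - w) / (z - w₀) by field_simp; ring]
  field_simp
  ring

theorem windingNumber_eq_zero_of_norm_lt {w : ℂ} (h : ∀ z ∈ Γ.trace, ‖z‖ < ‖w‖) :
    Γ.windingNumber w = 0 := by
  rw [windingNumber]
  have hw : w ∉ Γ.trace := fun hw => lt_irrefl _ (h w hw)
  -- For `w = 0` the hypothesis forces the trace to be empty, and any primitive will do.
  rcases eq_or_ne w 0 with rfl | hw0
  · rw [Γ.integral_eq_zero_of_hasDerivAt (G := fun _ => 0) (Γ.continuousOn_sub_inv hw)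
      fun z hz => absurd (h z hz) (by simp), mul_zero]
  rw [Γ.integral_eq_zero_of_hasDerivAt (G := fun z => log (1 - z / w)) (Γ.continuousOn_sub_inv hw),
    mul_zero]
  intro z hz
  have h2 : z - w ≠ 0 := sub_ne_zero.2 fun e => hw (e ▸ hz)
  have h3 : 1 - z / w ∈ slitPlane := by
    apply one_sub_mem_slitPlane
    rw [norm_div]
    exact (div_lt_one (norm_pos_iff.2 hw0)).2 (h z hz)
  have h4 : HasDerivAt (fun z => 1 - z / w) (- (1 / w)) z :=
    ((hasDerivAt_id z).div_const w).const_sub 1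
  refine (h4.clog h3).congr_deriv ?_
  rw [show 1 - z / w = -((z - w) / w) by field_simp; ring]
  field_simp

theorem windingNumber_eventuallyEq {w₀ : ℂ} (hw₀ : w₀ ∉ Γ.trace) :
    Γ.windingNumber =ᶠ[𝓝 w₀] fun _ => Γ.windingNumber w₀ := by
  obtain ⟨ε, hε, hb⟩ := Metric.isOpen_iff.1 Γ.isCompact_trace.isClosed.isOpen_compl w₀ hw₀
  filter_upwards [Metric.ball_mem_nhds w₀ hε] with w hw
  refine Γ.windingNumber_eq_of_dist_lt fun z hz => ?_
  by_contra hlt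
  exact hb (Metric.mem_ball.2 ((not_lt.1 hlt).trans_lt (Metric.mem_ball.1 hw))) hz

variable [CompleteSpace E]

/-- A contour integral of a holomorphic function as an area integral. -/
theorem integral_eq_integral_dbar {U : Set ℂ} (hU : IsOpen U) {F : ℂ → E}
    (hF : DifferentiableOn ℂ F U) {ψ : ℂ → ℂ} (hψ : IsCutoff ψ Γ.trace U) :
    Γ.integral F = (2 * I) • ∫ w, Γ.windingNumber w • dbar ψ w • F w := by
  set D := tsupport (dbar ψ) with hD
  have hDc : IsCompact D := hψ.hasCompactSupport.dbar
  have hDU : D ⊆ U := (tsupport_dbar_subset ψ).trans hψ.tsupport_subset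
  have hDΓ : ∀ w ∈ D, w ∉ Γ.trace := fun w hw h => hψ.notMem_tsupport_dbar h hw
  have hdc := hψ.contDiff.continuous_dbar
  -- Cauchy–Pompeiu for `ψ F`, where `ψ = 1` on the trace. Since `D` stays off the trace, the kernel
  -- is continuous and Fubini applies; the inner contour integral of the kernel gives the winding
  -- number.
  have h1 : ∀ z ∈ Γ.trace, F z = -(Real.pi : ℂ)⁻¹ • ∫ w in D, (w - z)⁻¹ • dbar ψ w • F w := by
    intro z hz
    rw [setIntegral_eq_integral_of_forall_compl_eq_zero,
      integral_sub_inv_dbar_smul hU hψ.contDiff hψ.hasCompactSupport hψ.tsupport_subset hF,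
      hψ.apply_eq_one hz, one_smul, smul_smul]
    · simp [Real.pi_ne_zero]
    · intro w hw
      simp [image_eq_zero_of_notMem_tsupport hw]
  have hint : ∀ i, Integrable (Function.uncurry fun t w => (derivWithin (Γ.arc i) (Icc 0 1) t •
      (Γ.arc i t - w)⁻¹) • dbar ψ w • F w)
      ((volume.restrict (Icc (0 : ℝ) 1)).prod (volume.restrict D)) := by
    intro i
    rw [Measure.prod_restrict, ← Measure.volume_eq_prod]
    refine ContinuousOn.integrableOn_compact (isCompact_Icc.prod hDc) ?_
    have c1 : ContinuousOn (fun p : ℝ × ℂ => Γ.arc i p.1) (Icc 0 1 ×ˢ D) :=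
      (Γ.continuousOn_arc i).comp continuousOn_fst fun p hp => hp.1
    have c2 : ContinuousOn (fun p : ℝ × ℂ => derivWithin (Γ.arc i) (Icc 0 1) p.1)
        (Icc 0 1 ×ˢ D) :=
      (Γ.continuousOn_derivWithin_arc i).comp continuousOn_fst fun p hp => hp.1
    have c3 : ContinuousOn (fun p : ℝ × ℂ => F p.2) (Icc 0 1 ×ˢ D) :=
      (hF.continuousOn.mono hDU).comp continuousOn_snd fun p hp => hp.2
    refine (c2.smul ((c1.sub continuousOn_snd).inv₀ ?_)).smul
      ((hdc.comp continuous_snd).continuousOn.smul c3)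
    intro p hp
    exact sub_ne_zero.2 fun e => hDΓ p.2 hp.2
      ((show Γ.arc i p.1 = p.2 from e) ▸ Γ.arc_mem_trace hp.1)
  have h3 : ∀ i w, (∫ t in (0 : ℝ)..1, derivWithin (Γ.arc i) (Icc 0 1) t •
      (Γ.arc i t - w)⁻¹) • dbar ψ w • F w = ∫ t in Icc (0 : ℝ) 1,
      (derivWithin (Γ.arc i) (Icc 0 1) t • (Γ.arc i t - w)⁻¹) • dbar ψ w • F w := by
    intro i w
    rw [intervalIntegral.integral_of_le zero_le_one, ← integral_Icc_eq_integral_Ioc,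
      integral_smul_const]
  have h2 : ∀ i, ∫ t in (0 : ℝ)..1, derivWithin (Γ.arc i) (Icc 0 1) t • F (Γ.arc i t) =
      (Real.pi : ℂ)⁻¹ • ∫ w in D, (∫ t in (0 : ℝ)..1, derivWithin (Γ.arc i) (Icc 0 1) t •
        (Γ.arc i t - w)⁻¹) • dbar ψ w • F w := by
    intro i
    rw [intervalIntegral.integral_of_le zero_le_one, ← integral_Icc_eq_integral_Ioc]
    simp only [h3]
    rw [← integral_integral_swap (hint i), ← integral_smul]
    refine setIntegral_congr_fun measurableSet_Icc fun t ht => ?_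
    rw [h1 _ (Γ.arc_mem_trace ht), smul_comm, neg_smul, ← smul_neg, ← smul_neg, ← integral_neg,
      ← integral_smul]
    congr 1
    refine integral_congr_ae (Eventually.of_forall fun w => ?_)
    beta_reduce
    rw [← neg_sub w, inv_neg, smul_neg, smul_neg, neg_smul, smul_assoc]
  have h4 : ∀ i, IntegrableOn (fun w => (∫ t in (0 : ℝ)..1, derivWithin (Γ.arc i) (Icc 0 1) t •
        (Γ.arc i t - w)⁻¹) • dbar ψ w • F w) D := by
    intro i
    simp only [h3]
    exact (hint i).integral_prod_right
  rw [integral, Finset.sum_congr rfl fun i _ => h2 i, ← Finset.smul_sum, ← integral_finsetSum]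
  · rw [← setIntegral_eq_integral_of_forall_compl_eq_zero (s := D)
      (f := fun w => Γ.windingNumber w • dbar ψ w • F w), ← integral_smul, ← integral_smul]
    · refine integral_congr_ae (Eventually.of_forall fun w => ?_)
      simp only [windingNumber, integral, ← Finset.sum_smul]
      simp only [smul_smul]
      congr 1
      have := Real.pi_ne_zero
      field_simp
    · intro w hw
      simp [image_eq_zero_of_notMem_tsupport hw]
  · exact fun i _ => h4 i

end PlaneCycle

end Cycles

/-! ### The holomorphic functional calculus by area integrals -/

section FunctionalCalculus

section resolvent

variable {A : Type*} [NormedRing A] [NormedAlgebra ℂ A]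

theorem sub_mul_resolvent {T : A} {a : ℂ} (ha : a ∉ spectrum ℂ T) :
    (algebraMap ℂ A a - T) * resolvent T a = 1 :=
  Ring.mul_inverse_cancel _ (spectrum.notMem_iff.1 ha)

theorem resolvent_mul_sub {T : A} {a : ℂ} (ha : a ∉ spectrum ℂ T) :
    resolvent T a * (algebraMap ℂ A a - T) = 1 :=
  Ring.inverse_mul_cancel _ (spectrum.notMem_iff.1 ha)

theorem resolvent_mul_resolvent {T : A} {a z : ℂ} (ha : a ∉ spectrum ℂ T)
    (hz : z ∉ spectrum ℂ T) (haz : z ≠ a) :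
    resolvent T z * resolvent T a = (a - z)⁻¹ • (resolvent T z - resolvent T a) := by
  have h : resolvent T z - resolvent T a = (a - z) • (resolvent T z * resolvent T a) := by
    calc resolvent T z - resolvent T a
        = resolvent T z * ((algebraMap ℂ A a - T) * resolvent T a) -
          (resolvent T z * (algebraMap ℂ A z - T)) * resolvent T a := by
            rw [sub_mul_resolvent ha, resolvent_mul_sub hz, mul_one, one_mul]
      _ = resolvent T z * (algebraMap ℂ A a - algebraMap ℂ A z) * resolvent T a := by
            noncomm_ring
      _ = _ := by
            rw [← map_sub, Algebra.algebraMap_eq_smul_one, mul_smul_comm, mul_one, smul_mul_assoc]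
  rw [h, inv_smul_smul₀ (sub_ne_zero.2 haz.symm)]

variable [CompleteSpace A]

theorem differentiableOn_resolvent (T : A) :
    DifferentiableOn ℂ (resolvent T) (spectrum ℂ T)ᶜ := fun z hz =>
  (spectrum.hasDerivAt_resolvent_const_left (by simpa [spectrum] using hz)).differentiableAt.differentiableWithinAt

end resolvent

variable {A : Type*} [NormedRing A] [NormedAlgebra ℂ A] [CompleteSpace A]

/-- The holomorphic functional calculus as an area integral, `-π⁻¹ ∫ ∂̄χ(w) g(w) (w - T)⁻¹ dA(w)`;
here `χ` is a cutoff that equals `1` near the spectrum of `T`. -/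
def areaCalculus (T : A) (χ g : ℂ → ℂ) : A :=
  -(Real.pi : ℂ)⁻¹ • ∫ w, dbar χ w • g w • resolvent T w

theorem IsCutoff.integrable_dbar_smul {E : Type*} [NormedAddCommGroup E] [NormedSpace ℂ E]
    {χ : ℂ → ℂ} {S U : Set ℂ} (h : IsCutoff χ S U) {F : ℂ → E}
    (hF : ContinuousOn F (U \ S)) : Integrable (fun w => dbar χ w • F w) := by
  have hsub : tsupport (dbar χ) ⊆ U \ S := fun z hz =>
    ⟨h.tsupport_subset (tsupport_dbar_subset _ hz), fun hzS => h.notMem_tsupport_dbar hzS hz⟩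
  rw [← integrableOn_iff_integrable_of_support_subset (s := tsupport (dbar χ))]
  · exact (h.contDiff.continuous_dbar.continuousOn.smul (hF.mono hsub)).integrableOn_compact
      h.hasCompactSupport.dbar
  · intro z hz
    by_contra hn
    simp [image_eq_zero_of_notMem_tsupport hn] at hz

variable {T : A} {U : Set ℂ}

theorem differentiableOn_smul_resolvent {g : ℂ → ℂ} (hg : DifferentiableOn ℂ g U) :
    DifferentiableOn ℂ (fun w => g w • resolvent T w) (U \ spectrum ℂ T) :=
  (hg.mono sdiff_subset).smul ((differentiableOn_resolvent T).mono fun _ h => h.2)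

theorem integrable_areaCalculus {χ g : ℂ → ℂ} (hχ : IsCutoff χ (spectrum ℂ T) U)
    (hg : DifferentiableOn ℂ g U) : Integrable (fun w => dbar χ w • g w • resolvent T w) :=
  hχ.integrable_dbar_smul (differentiableOn_smul_resolvent hg).continuousOn

theorem dbar_sub {χ₁ χ₂ : ℂ → ℂ} (h₁ : ContDiff ℝ 1 χ₁) (h₂ : ContDiff ℝ 1 χ₂) (w : ℂ) :
    dbar (fun z => χ₁ z - χ₂ z) w = dbar χ₁ w - dbar χ₂ w := by
  have := fderiv_fun_sub (h₁.differentiable one_ne_zero w) (h₂.differentiable one_ne_zero w)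
  simp only [dbar, this, sub_apply, smul_eq_mul]
  ring

/-- The difference of the cutoffs is compactly supported in `U \ σ(T)`, where `g(w)(w - T)⁻¹` is
holomorphic, so its `∂̄` integrates to zero against that function. -/
theorem areaCalculus_eq_of_isCutoff {χ₁ χ₂ g : ℂ → ℂ} (hU : IsOpen U)
    (h₁ : IsCutoff χ₁ (spectrum ℂ T) U) (h₂ : IsCutoff χ₂ (spectrum ℂ T) U)
    (hg : DifferentiableOn ℂ g U) : areaCalculus T χ₁ g = areaCalculus T χ₂ g := by
  rw [areaCalculus, areaCalculus]
  congr 1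
  rw [← sub_eq_zero, ← integral_sub (integrable_areaCalculus h₁ hg) (integrable_areaCalculus h₂ hg)]
  simp only [← sub_smul, ← dbar_sub h₁.contDiff h₂.contDiff]
  refine integral_dbar_smul_eq_zero (hU.sdiff (spectrum.isClosed T))
    (h₁.contDiff.sub h₂.contDiff) (h₁.hasCompactSupport.sub h₂.hasCompactSupport) ?_
    (differentiableOn_smul_resolvent hg)
  intro z hz
  refine ⟨?_, fun hzσ => ?_⟩
  · exact union_subset h₁.tsupport_subset h₂.tsupport_subset (tsupport_sub χ₁ χ₂ hz)
  · refine notMem_tsupport_iff_eventuallyEq.2 ?_ hz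
    filter_upwards [h₁.eventuallyEq_one z hzσ, h₂.eventuallyEq_one z hzσ] with w hw₁ hw₂
    simp [hw₁, hw₂]

/-- The resolvent identity splits the integrand in two; the part containing the fixed operator
`resolvent T a` is holomorphic on `U \ {a}` and integrates to `0`. -/
theorem areaCalculus_mul_resolvent {χ g : ℂ → ℂ} (hU : IsOpen U)
    (hχ : IsCutoff χ (spectrum ℂ T) U) (hg : DifferentiableOn ℂ g U) {a : ℂ}
    (ha : a ∉ tsupport χ) :
    areaCalculus T χ g * resolvent T a = areaCalculus T χ (fun z => (a - z)⁻¹ * g z) := by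
  have hχ' : IsCutoff χ (spectrum ℂ T) (U \ {a}) :=
    ⟨hχ.1, hχ.2, fun z hz => ⟨hχ.tsupport_subset hz, fun h => ha (h ▸ hz)⟩, hχ.4⟩
  have haσ : a ∉ spectrum ℂ T := fun h => ha (hχ.subset_tsupport h)
  have hU' : IsOpen (U \ {a}) := hU.sdiff isClosed_singleton
  have hg' : DifferentiableOn ℂ (fun z => (a - z)⁻¹ * g z) (U \ {a}) :=
    ((differentiableOn_const a).sub differentiableOn_id).inv (fun z hz =>
      sub_ne_zero.2 fun e => hz.2 e.symm) |>.mul (hg.mono sdiff_subset)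
  rw [areaCalculus, areaCalculus, smul_mul_assoc]
  congr 1
  have h0 : ∫ w, dbar χ w • (((a - w)⁻¹ * g w) • resolvent T a) = 0 :=
    integral_dbar_smul_eq_zero hU' hχ'.contDiff hχ'.hasCompactSupport hχ'.tsupport_subset
      (hg'.smul_const _)
  have hi0 : Integrable fun w => dbar χ w • (((a - w)⁻¹ * g w) • resolvent T a) :=
    hχ'.integrable_dbar_smul ((hg'.smul_const _).continuousOn.mono sdiff_subset)
  rw [← integral_mul_const_of_integrable (integrable_areaCalculus hχ hg),
    ← sub_zero (∫ w, dbar χ w • ((a - w)⁻¹ * g w) • resolvent T w), ← h0,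
    ← integral_sub (integrable_areaCalculus hχ' hg') hi0]
  refine integral_congr_ae (Eventually.of_forall fun w => ?_)
  simp only
  by_cases hw : w ∈ tsupport (dbar χ)
  · have hwσ : w ∉ spectrum ℂ T := fun h => hχ.notMem_tsupport_dbar h hw
    have hwa : w ≠ a := fun h => ha (h ▸ tsupport_dbar_subset _ hw)
    rw [smul_mul_assoc, smul_mul_assoc, resolvent_mul_resolvent haσ hwσ hwa]
    module
  · simp [image_eq_zero_of_notMem_tsupport hw]

theorem IsCutoff.comp_inv_smul {χ : ℂ → ℂ} (hχ : IsCutoff χ (Metric.closedBall 0 1) univ) {r : ℝ}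
    (hr : 0 < r) : IsCutoff (fun z => χ (r⁻¹ • z)) (Metric.closedBall 0 r) univ := by
  refine ⟨hχ.contDiff.comp (contDiff_const_smul _), ?_, subset_univ _, fun z hz => ?_⟩
  · exact hχ.hasCompactSupport.comp_smul (inv_ne_zero hr.ne')
  · have h1 : Tendsto (fun z : ℂ => r⁻¹ • z) (𝓝 z) (𝓝 (r⁻¹ • z)) :=
      (continuous_const_smul r⁻¹).continuousAt
    refine (hχ.eventuallyEq_one (r⁻¹ • z) ?_).comp_tendsto h1
    rw [mem_closedBall_zero_iff] at hz ⊢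
    rw [norm_smul, norm_inv, Real.norm_eq_abs, abs_of_pos hr]
    exact (inv_mul_le_one₀ hr).2 hz

/-- The cutoff may be replaced by a dilate `χ₀(z / r)` for any large `r`. After rescaling, the
integrand involves `r (r w - T)⁻¹`, which tends to `w⁻¹` as `r → ∞`; Cauchy–Pompeiu at `0` evaluates
the limit. -/
theorem areaCalculus_one {χ : ℂ → ℂ} (hχ : IsCutoff χ (spectrum ℂ T) U) :
    areaCalculus T χ (fun _ => 1) = 1 := by
  obtain ⟨χ₀, hχ₀⟩ := exists_isCutoff (isCompact_closedBall (0 : ℂ) 1) isOpen_univ (subset_univ _)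
  have h1 : ∀ r : ℝ, 0 < r → ‖T‖ * ‖(1 : A)‖ ≤ r →
      (Integrable fun w => dbar χ₀ w • r • resolvent T (r • w)) ∧
      areaCalculus T χ (fun _ => 1) =
        -(Real.pi : ℂ)⁻¹ • ∫ w, dbar χ₀ w • r • resolvent T (r • w) := by
    intro r hr hTr
    have hχr : IsCutoff (fun z => χ₀ (r⁻¹ • z)) (spectrum ℂ T) univ :=
      (hχ₀.comp_inv_smul hr).anti ((spectrum.subset_closedBall_norm_mul T).trans
        (Metric.closedBall_subset_closedBall hTr))
    have hd : ∀ z, dbar (fun z => χ₀ (r⁻¹ • z)) z = r⁻¹ • dbar χ₀ (r⁻¹ • z) := by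
      intro z
      have := fderiv_comp_smul (𝕜 := ℝ) (f := χ₀) (x := z) r⁻¹
      simp only [dbar, this, smul_apply]
      module
    have hint := integrable_areaCalculus hχr (differentiableOn_const (1 : ℂ))
    set k : ℂ → A := fun z => dbar (fun z => χ₀ (r⁻¹ • z)) z • (1 : ℂ) • resolvent T z with hk
    have h2 : ∀ w, dbar χ₀ w • r • resolvent T (r • w) = (r ^ 2) • k (r • w) := by
      intro w
      simp only [hk, hd, one_smul, inv_smul_smul₀ hr.ne']
      rw [smul_assoc, smul_smul, smul_comm]
      congr 1
      field_simp
    refine ⟨?_, ?_⟩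
    · simp only [h2]
      exact ((integrable_comp_smul_iff volume _ hr.ne').2 hint).smul _
    · rw [areaCalculus_eq_of_isCutoff isOpen_univ (hχ.mono (subset_univ _)) hχr
        (differentiableOn_const 1), areaCalculus]
      simp only [h2]
      rw [integral_smul, Measure.integral_comp_smul volume k]
      congr 1
      rw [Complex.finrank_real_complex, smul_smul, abs_of_pos (by positivity),
        mul_inv_cancel₀ (by positivity), one_smul]
  have hlim : Tendsto (fun r : ℝ => ∫ w, dbar χ₀ w • r • resolvent T (r • w)) atTop
      (𝓝 (∫ w, dbar χ₀ w • (w⁻¹ • (1 : A)))) := by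
    -- The resolvent is `O(1/|z|)` at infinity, and `|w| > 1` on the support of `∂̄χ₀`; together
    -- they give an integrable majorant.
    obtain ⟨C, hC⟩ := (spectrum.resolvent_isBigO_inv (𝕜 := ℂ) T).bound
    obtain ⟨M, -, hM⟩ := hasBasis_cobounded_norm.eventually_iff.1 hC
    have hC' : ∀ w ∈ tsupport (dbar χ₀), 1 < ‖w‖ := fun w hw => by
      by_contra h
      exact hχ₀.notMem_tsupport_dbar (mem_closedBall_zero_iff.2 (not_lt.1 h)) hw
    refine tendsto_integral_filter_of_dominated_convergence (fun w => |C| * ‖dbar χ₀ w‖) ?_ ?_ ?_ ?_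
    · filter_upwards [eventually_gt_atTop 0, eventually_ge_atTop (‖T‖ * ‖(1 : A)‖)] with r hr hr'
      exact (h1 r hr hr').1.aestronglyMeasurable
    · filter_upwards [eventually_gt_atTop 0, eventually_ge_atTop M] with r hr hrM
      refine Eventually.of_forall fun w => ?_
      by_cases hw : w ∈ tsupport (dbar χ₀)
      · have h2 := hC' w hw
        have h3 : ‖r • w‖ = r * ‖w‖ := by rw [norm_smul, Real.norm_eq_abs, abs_of_pos hr]
        have h4 : ‖resolvent T (r • w)‖ ≤ C * ‖(r • w)⁻¹‖ :=
          hM (show M ≤ ‖r • w‖ by rw [h3]; nlinarith)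
        rw [norm_smul, norm_smul, mul_comm, Real.norm_eq_abs, abs_of_pos hr]
        gcongr
        calc r * ‖resolvent T (r • w)‖ ≤ r * (C * ‖(r • w)⁻¹‖) := by gcongr
          _ = C / ‖w‖ := by rw [norm_inv, h3]; field_simp
          _ ≤ |C| / 1 := by gcongr; exact le_abs_self C
          _ = |C| := div_one _
      · simp [image_eq_zero_of_notMem_tsupport hw]
    · exact ((hχ₀.contDiff.continuous_dbar.integrable_of_hasCompactSupport
        hχ₀.hasCompactSupport.dbar).norm).const_mul _
    · refine Eventually.of_forall fun w => ?_
      by_cases hw : w ∈ tsupport (dbar χ₀)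
      · refine Tendsto.const_smul ?_ _
        have hw0 : w ≠ 0 := norm_pos_iff.1 (zero_lt_one.trans (hC' w hw))
        have hcob : Tendsto (fun r : ℝ => r • w) atTop (Bornology.cobounded ℂ) := by
          rw [← tendsto_norm_atTop_iff_cobounded]
          simp only [norm_smul]
          exact tendsto_norm_atTop_atTop.atTop_mul_const (norm_pos_iff.2 hw0)
        have h2 : Tendsto (fun z : ℂ => z • resolvent T z) (Bornology.cobounded ℂ) (𝓝 1) := by
          have h3 : Tendsto (fun z : ℂ => 1 + T * resolvent T z) (Bornology.cobounded ℂ)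
              (𝓝 (1 + T * 0)) :=
            ((spectrum.resolvent_tendsto_cobounded T).const_mul T).const_add 1
          rw [mul_zero, add_zero] at h3
          refine h3.congr' ?_
          filter_upwards [(Bornology.isBounded_def.1 (spectrum.isBounded (𝕜 := ℂ) T))] with z hz
          rw [← sub_mul_resolvent hz, sub_mul, sub_add_cancel, Algebra.algebraMap_eq_smul_one,
            smul_mul_assoc, one_mul]
        refine ((h2.comp hcob).const_smul w⁻¹).congr fun r => ?_
        simp only [Function.comp_apply]
        rw [← Complex.coe_smul, ← Complex.coe_smul, smul_smul, smul_eq_mul]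
        congr 1
        field_simp
      · simp [image_eq_zero_of_notMem_tsupport hw]
  have hval : ∫ w, dbar χ₀ w • (w⁻¹ • (1 : A)) = -(Real.pi : ℂ) • (1 : A) := by
    have := integral_sub_inv_dbar_smul isOpen_univ hχ₀.contDiff hχ₀.hasCompactSupport
      (subset_univ _) (differentiableOn_const (1 : A)) 0
    rw [hχ₀.apply_eq_one (by simp), one_smul] at this
    rw [← this]
    simp only [sub_zero]
    exact integral_congr_ae (Eventually.of_forall fun w => smul_comm _ _ _)
  have h3 : Tendsto (fun r : ℝ => -(Real.pi : ℂ)⁻¹ • ∫ w, dbar χ₀ w • r • resolvent T (r • w)) atTop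
      (𝓝 (areaCalculus T χ (fun _ => 1))) := by
    refine tendsto_const_nhds.congr' ?_
    filter_upwards [eventually_gt_atTop 0, eventually_ge_atTop (‖T‖ * ‖(1 : A)‖)] with r hr hr'
    exact (h1 r hr hr').2
  rw [tendsto_nhds_unique h3 (hlim.const_smul _), hval, smul_smul]
  simp [Real.pi_ne_zero]

/-- Take for `h` a second cutoff `χ₂` that is `1` near the support of `χ`. Then every `w` in the
support of `∂̄χ₂` avoids the support of `χ`, so `g(T)(w - T)⁻¹` is the calculus of `g(z)/(w - z)`.
After Fubini the integral in `w` is Cauchy–Pompeiu for `χ₂ h` and returns `h(z)`. -/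
theorem areaCalculus_mul {χ g h : ℂ → ℂ} (hU : IsOpen U) (hχ : IsCutoff χ (spectrum ℂ T) U)
    (hg : DifferentiableOn ℂ g U) (hh : DifferentiableOn ℂ h U) :
    areaCalculus T χ g * areaCalculus T χ h = areaCalculus T χ (fun z => g z * h z) := by
  obtain ⟨χ₂, hχ₂⟩ := exists_isCutoff hχ.hasCompactSupport hU hχ.tsupport_subset
  have hχ₂' : IsCutoff χ₂ (spectrum ℂ T) U := hχ₂.anti hχ.subset_tsupport
  rw [areaCalculus_eq_of_isCutoff hU hχ hχ₂' hh]
  set D₁ := tsupport (dbar χ)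
  set D₂ := tsupport (dbar χ₂)
  have hD₁ : IsCompact D₁ := hχ.hasCompactSupport.dbar
  have hD₂ : IsCompact D₂ := hχ₂.hasCompactSupport.dbar
  have hdis : ∀ z ∈ D₁, ∀ w ∈ D₂, w - z ≠ 0 := fun z hz w hw e =>
    hχ₂.notMem_tsupport_dbar (tsupport_dbar_subset _ hz) (sub_eq_zero.1 e ▸ hw)
  have e1 : areaCalculus T χ g * areaCalculus T χ₂ h = -(Real.pi : ℂ)⁻¹ • ∫ w in D₂,
      ∫ z in D₁, (-(Real.pi : ℂ)⁻¹ * ((w - z)⁻¹ * dbar χ₂ w * h w)) •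
        (dbar χ z • g z • resolvent T z) := by
    rw [areaCalculus, areaCalculus, mul_smul_comm, ← areaCalculus]
    congr 1
    rw [← integral_const_mul_of_integrable (integrable_areaCalculus hχ₂' hh),
      ← setIntegral_eq_integral_of_forall_compl_eq_zero (s := D₂)]
    · refine setIntegral_congr_fun hD₂.measurableSet fun w hw => ?_
      rw [mul_smul_comm, mul_smul_comm, areaCalculus_mul_resolvent hU hχ hg
        (fun hw' => hχ₂.notMem_tsupport_dbar hw' hw), areaCalculus,
        ← setIntegral_eq_integral_of_forall_compl_eq_zero (s := D₁), ← integral_smul,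
        ← integral_smul, ← integral_smul]
      · refine integral_congr_ae (Eventually.of_forall fun z => ?_)
        simp only
        module
      · intro z hz
        simp [image_eq_zero_of_notMem_tsupport hz]
    · intro z hz
      simp [image_eq_zero_of_notMem_tsupport hz]
  rw [e1, integral_integral_swap]
  · rw [areaCalculus]
    congr 1
    rw [← setIntegral_eq_integral_of_forall_compl_eq_zero (s := D₁)
      (f := fun w => dbar χ w • (g w * h w) • resolvent T w)]
    · refine setIntegral_congr_fun hD₁.measurableSet fun z hz => ?_
      have h1 := integral_sub_inv_dbar_smul hU hχ₂.contDiff hχ₂.hasCompactSupport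
        hχ₂.tsupport_subset hh z
      rw [← setIntegral_eq_integral_of_forall_compl_eq_zero (s := D₂),
        hχ₂.apply_eq_one (tsupport_dbar_subset _ hz)] at h1
      · rw [integral_smul_const, integral_const_mul]
        simp only [smul_eq_mul, ← mul_assoc, mul_one] at h1
        rw [h1]
        have := Real.pi_ne_zero
        match_scalars
        field_simp
      · intro w hw
        simp [image_eq_zero_of_notMem_tsupport hw]
    · intro z hz
      simp [image_eq_zero_of_notMem_tsupport hz]
  · rw [Measure.prod_restrict, ← Measure.volume_eq_prod]
    refine ContinuousOn.integrableOn_compact (hD₂.prod hD₁) ?_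
    have c1 : ContinuousOn (fun p : ℂ × ℂ => (p.1 - p.2)⁻¹) (D₂ ×ˢ D₁) :=
      (by fun_prop : ContinuousOn (fun p : ℂ × ℂ => p.1 - p.2) (D₂ ×ˢ D₁)).inv₀
        fun p hp => hdis _ hp.2 _ hp.1
    have c2 : ContinuousOn (fun p : ℂ × ℂ => h p.1) (D₂ ×ˢ D₁) :=
      (hh.continuousOn.mono ((tsupport_dbar_subset _).trans hχ₂.tsupport_subset)).comp
        continuousOn_fst fun p hp => hp.1
    have c3 : ContinuousOn (fun p : ℂ × ℂ => g p.2 • resolvent T p.2) (D₂ ×ˢ D₁) :=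
      ((differentiableOn_smul_resolvent hg).continuousOn.mono fun z hz =>
        ⟨hχ.tsupport_subset (tsupport_dbar_subset _ hz),
          fun hzσ => hχ.notMem_tsupport_dbar hzσ hz⟩).comp continuousOn_snd fun p hp => hp.2
    exact (continuousOn_const.mul ((c1.mul
      (hχ₂.contDiff.continuous_dbar.comp continuous_fst).continuousOn).mul c2)).smul
      ((hχ.contDiff.continuous_dbar.comp continuous_snd).continuousOn.smul c3)

/-- The Riesz–Dunford integral as an area integral. -/
theorem exists_isCutoff_rieszDunford_eq {X : Type*} [NormedAddCommGroup X] [NormedSpace ℂ X]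
    [CompleteSpace X] {T : X →L[ℂ] X} {Ω : Set ℂ} (hΩ : IsOpen Ω) {f : ℂ → ℂ}
    (hf : DifferentiableOn ℂ f Ω) {Γ : PlaneCycle} (hΓ : Γ.Surrounds (spectrum ℂ T) Ω) :
    ∃ χ, IsCutoff χ (spectrum ℂ T) Ω ∧ rieszDunford f T Γ = areaCalculus T χ f := by
  obtain ⟨hΓ1, hΓ2, hΓ3⟩ := hΓ
  obtain ⟨ψ, hψ⟩ := exists_isCutoff Γ.isCompact_trace (hΩ.sdiff (spectrum.isClosed T)) hΓ1
  -- This is `C¹`, since the winding number is locally constant off the trace and `1 - ψ` vanishes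
  -- near it. It is `1` near `σ(T)`, `0` near each point outside `Ω` and far out, and `∂̄χ` is minus
  -- the winding number times `∂̄ψ`.
  set χ : ℂ → ℂ := fun w => Γ.windingNumber w * (1 - ψ w) with hχ
  have hloc : ∀ w, w ∉ Γ.trace → χ =ᶠ[𝓝 w] fun z => Γ.windingNumber w * (1 - ψ z) := by
    intro w hw
    filter_upwards [Γ.windingNumber_eventuallyEq hw] with z hz
    simp [hχ, hz]
  have hloc' : ∀ w ∈ Γ.trace, χ =ᶠ[𝓝 w] fun z => 0 := by
    intro w hw
    filter_upwards [hψ.eventuallyEq_one w hw] with z hz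
    simp [hχ, hz]
  have hdb : ∀ w, dbar χ w = -(Γ.windingNumber w * dbar ψ w) := by
    intro w
    by_cases hw : w ∈ Γ.trace
    · rw [dbar_eq_zero_of_eventuallyEq_const (hloc' w hw),
        dbar_eq_zero_of_eventuallyEq_const (hψ.eventuallyEq_one w hw)]
      simp
    · rw [(hloc w hw).dbar_eq]
      have h1 := dbar_holomorphic_smul (h := fun _ => Γ.windingNumber w) (u := fun z => 1 - ψ z)
        (differentiableAt_const _)
        ((hψ.contDiff.differentiable one_ne_zero w).const_sub 1)
      have h2 := dbar_sub (χ₁ := fun _ => (1 : ℂ)) contDiff_const hψ.contDiff w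
      rw [dbar_eq_zero_of_eventuallyEq_const (u := fun _ => (1 : ℂ)) EventuallyEq.rfl] at h2
      simp only [smul_eq_mul] at h1
      rw [h1, h2]
      ring
  have hsupp : tsupport χ ⊆ Ω := by
    intro w hw
    by_contra hwΩ
    refine notMem_tsupport_iff_eventuallyEq.2 ?_ hw
    have hwt : w ∉ Γ.trace := fun h => hwΩ (hΓ1 h).1
    filter_upwards [hloc w hwt] with z hz
    rw [hz, hΓ3 w hwΩ]
    simp
  refine ⟨χ, ⟨?_, ?_, hsupp, ?_⟩, ?_⟩
  · refine contDiff_iff_contDiffAt.2 fun w => ?_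
    by_cases hw : w ∈ Γ.trace
    · exact contDiffAt_const.congr_of_eventuallyEq (hloc' w hw)
    · exact (contDiffAt_const.mul (contDiffAt_const.sub hψ.contDiff.contDiffAt)).congr_of_eventuallyEq
        (hloc w hw)
  · obtain ⟨ρ, hρ⟩ := Γ.isCompact_trace.isBounded.subset_closedBall 0
    refine HasCompactSupport.of_support_subset_isCompact (isCompact_closedBall (0 : ℂ) ρ) ?_
    intro w hw
    by_contra hwρ
    rw [mem_closedBall_zero_iff, not_le] at hwρ
    refine hw ?_
    simp only [hχ]
    rw [Γ.windingNumber_eq_zero_of_norm_lt fun z hz =>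
      (mem_closedBall_zero_iff.1 (hρ hz)).trans_lt hwρ, zero_mul]
  · intro w hw
    have hwt : w ∉ Γ.trace := fun h => (hΓ1 h).2 hw
    have hwψ : w ∉ tsupport ψ := fun h => (hψ.tsupport_subset h).2 hw
    filter_upwards [hloc w hwt, notMem_tsupport_iff_eventuallyEq.1 hwψ] with z hz hz'
    rw [hz, hΓ2 w hw, hz']
    simp
  · rw [rieszDunford, areaCalculus, Γ.integral_eq_integral_dbar (hΩ.sdiff (spectrum.isClosed T))
      (differentiableOn_smul_resolvent hf) hψ, smul_smul, neg_smul, ← smul_neg, ← integral_neg]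
    congr 1
    · have := Real.pi_ne_zero
      field_simp
    · refine integral_congr_ae (Eventually.of_forall fun w => ?_)
      simp only [hdb, neg_smul, neg_neg, mul_smul]

end FunctionalCalculus

open Metric

/-! ### Roots of `f = b` and distortion of distances -/

section FunctionTheory

section division

variable {V : Set ℂ}

/-- A holomorphic function vanishing at the zeros of `F`, all of them simple, is divisible by
`F`. -/
theorem exists_differentiableOn_eq_mul (hV : IsOpen V) {F g : ℂ → ℂ} (hF : DifferentiableOn ℂ F V)
    (hg : DifferentiableOn ℂ g V) (h : ∀ z ∈ V, F z = 0 → g z = 0 ∧ deriv F z ≠ 0) :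
    ∃ q, DifferentiableOn ℂ q V ∧ ∀ z ∈ V, g z = q z * F z := by
  classical
  refine ⟨fun z => if F z = 0 then deriv g z / deriv F z else g z / F z, fun z₀ hz₀ => ?_,
    fun z hz => ?_⟩
  · refine DifferentiableAt.differentiableWithinAt ?_
    have hV₀ := hV.mem_nhds hz₀
    by_cases h0 : F z₀ = 0
    · obtain ⟨hg0, hd0⟩ := h z₀ hz₀ h0
      have dF := ((differentiableOn_dslope hV₀).2 hF).differentiableAt hV₀
      have dg := ((differentiableOn_dslope hV₀).2 hg).differentiableAt hV₀
      have hne : dslope F z₀ z₀ ≠ 0 := by rwa [dslope_same]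
      refine (dg.fun_div dF hne).congr_of_eventuallyEq ?_
      filter_upwards [dF.continuousAt.eventually_ne hne] with z hz
      rcases eq_or_ne z z₀ with rfl | hzz
      · simp [h0, dslope_same]
      · rw [dslope_of_ne _ hzz, slope_def_field, h0, sub_zero] at hz
        have hFz : F z ≠ 0 := fun e => hz (by rw [e, zero_div])
        have hs : z - z₀ ≠ 0 := sub_ne_zero.2 hzz
        simp only [hFz, if_false, dslope_of_ne _ hzz, slope_def_field, h0, hg0, sub_zero]
        field_simp
    · refine ((hg.differentiableAt hV₀).fun_div (hF.differentiableAt hV₀) h0).congr_of_eventuallyEq ?_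
      filter_upwards [(hF.differentiableAt hV₀).continuousAt.eventually_ne h0] with z hz
      simp [hz]
  · by_cases h0 : F z = 0
    · simp [h0, (h z hz h0).1]
    · simp [h0]

end division

/-- A Schwarz lemma for functions with several zeros near the centre of a disc. -/
theorem norm_le_of_zeros {U : Set ℂ} (hU : IsOpen U) {p : ℂ} {r M : ℝ} (hr : 0 < r)
    (hrU : closedBall p r ⊆ U) (Z : Finset ℂ) (hZ : ∀ z ∈ Z, z ∈ ball p (r / 4)) {F : ℂ → ℂ}
    (hF : DifferentiableOn ℂ F U) (hM : ∀ z ∈ sphere p r, ‖F z‖ ≤ M) (h0 : ∀ z ∈ Z, F z = 0)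
    {z : ℂ} (hz : z ∈ ball p (r / 4)) : ‖F z‖ ≤ M * (2 / 3) ^ Z.card := by
  classical
  induction Z using Finset.induction_on generalizing F M with
  | empty =>
    simp only [Finset.card_empty, pow_zero, mul_one]
    refine norm_le_of_forall_mem_frontier_norm_le (isBounded_ball (x := p) (r := r))
      (hF.diffContOnCl_ball hrU) ?_ (subset_closure (ball_subset_ball (by linarith) hz))
    rwa [frontier_ball _ hr.ne']
  | insert a Z ha ih =>
    have haU : U ∈ 𝓝 a := hU.mem_nhds
      (hrU (ball_subset_closedBall (ball_subset_ball (by linarith) (hZ a (by simp)))))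
    have hab : dist a p < r / 4 := hZ a (by simp)
    have hFa : F a = 0 := h0 a (by simp)
    -- Dividing by `z - a` costs at most `(3r/4)⁻¹` on the sphere, and multiplying back costs at
    -- most `r/2` on the small ball: each zero contributes `2/3`.
    have hM' : ∀ w ∈ sphere p r, ‖dslope F a w‖ ≤ M / (3 * r / 4) := by
      intro w hw
      have h1 : 3 * r / 4 ≤ ‖w - a‖ := by
        rw [← dist_eq_norm]
        have := dist_triangle w a p
        rw [mem_sphere.1 hw] at this
        linarith
      have hne : w ≠ a := by
        rintro rfl
        simp at h1
        linarith
      rw [dslope_of_ne _ hne, slope_def_field, hFa, sub_zero, norm_div]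
      have := hM w hw
      have h2 := (norm_nonneg _).trans this
      gcongr
    have h1 := ih (fun w hw => hZ w (Finset.mem_insert_of_mem hw))
      ((differentiableOn_dslope haU).2 hF) hM' (fun w hw => by
        have hne : w ≠ a := fun e => ha (e ▸ hw)
        rw [dslope_of_ne _ hne, slope_def_field, hFa, h0 w (Finset.mem_insert_of_mem hw)]
        simp)
    have h2 : F z = (z - a) * dslope F a z := by
      have := sub_smul_dslope F a z
      rw [hFa, sub_zero, smul_eq_mul] at this
      exact this.symm
    have h3 : ‖z - a‖ ≤ r / 2 := by
      rw [← dist_eq_norm]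
      have := dist_triangle_right z a p
      rw [mem_ball] at hz
      linarith
    rw [h2, norm_mul, Finset.card_insert_of_notMem ha]
    calc ‖z - a‖ * ‖dslope F a z‖ ≤ r / 2 * (M / (3 * r / 4) * (2 / 3) ^ Z.card) := by gcongr
      _ = M * (2 / 3) ^ (Z.card + 1) := by
        rw [pow_succ]; field_simp; ring

variable {f : ℂ → ℂ} {Ω : Set ℂ}

theorem not_eventually_eq_const (hf : AnalyticOnNhd ℂ f Ω)
    (hnc : ∀ z ∈ Ω, ¬ ∃ c : ℂ, ∀ w ∈ connectedComponentIn Ω z, f w = c) {p : ℂ} (hp : p ∈ Ω)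
    (c : ℂ) : ¬ ∀ᶠ z in 𝓝 p, f z = c := by
  intro h
  refine hnc p hp ⟨c, fun w hw => ?_⟩
  exact (hf.mono (connectedComponentIn_subset Ω p)).eqOn_of_preconnected_of_eventuallyEq
    (analyticOnNhd_const (v := c)) isPreconnected_connectedComponentIn
    (mem_connectedComponentIn hp) h hw

/-- If `f = c` at many points of a small ball, the Schwarz lemma makes `f - c` tiny on it, while `f`
takes two distinct values there that do not depend on `c`. Compactness globalizes the bound. -/
theorem exists_card_le_of_isCompact (hΩ : IsOpen Ω) (hf : DifferentiableOn ℂ f Ω)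
    (hnl : ∀ p ∈ Ω, ∀ c, ¬ ∀ᶠ z in 𝓝 p, f z = c) {L : Set ℂ} (hL : IsCompact L) (hLΩ : L ⊆ Ω) :
    ∃ N : ℕ, ∀ (c : ℂ) (Z : Finset ℂ), (∀ z ∈ Z, z ∈ L ∧ f z = c) → Z.card ≤ N := by
  classical
  refine hL.induction_on (p := fun S => ∃ N : ℕ, ∀ (c : ℂ) (Z : Finset ℂ),
    (∀ z ∈ Z, z ∈ S ∧ f z = c) → Z.card ≤ N) ?_ ?_ ?_ ?_
  · refine ⟨0, fun c Z hZ => ?_⟩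
    rw [Finset.eq_empty_of_forall_notMem fun z hz => (hZ z hz).1]
    simp
  · rintro S S' hS ⟨N, hN⟩
    exact ⟨N, fun c Z hZ => hN c Z fun z hz => ⟨hS (hZ z hz).1, (hZ z hz).2⟩⟩
  · rintro S S' ⟨N, hN⟩ ⟨N', hN'⟩
    refine ⟨N + N', fun c Z hZ => ?_⟩
    rw [← Finset.card_filter_add_card_filter_not (s := Z) (· ∈ S)]
    refine add_le_add (hN c _ fun z hz => ?_) (hN' c _ fun z hz => ?_)
    · rw [Finset.mem_filter] at hz
      exact ⟨hz.2, (hZ z hz.1).2⟩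
    · rw [Finset.mem_filter] at hz
      exact ⟨(hZ z hz.1).1.resolve_left hz.2, (hZ z hz.1).2⟩
  · intro p hp
    obtain ⟨r, hr, hrΩ⟩ := nhds_basis_closedBall.mem_iff.1 (hΩ.mem_nhds (hLΩ hp))
    obtain ⟨M, hM⟩ := (isCompact_closedBall p r).exists_bound_of_continuousOn
      (hf.continuousOn.mono hrΩ)
    obtain ⟨z₁, hz₁, hne⟩ : ∃ z ∈ ball p (r / 4), f z ≠ f p := by
      by_contra! h
      exact hnl p (hLΩ hp) (f p) (eventually_of_mem (ball_mem_nhds p (by positivity)) h)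
    have hpos : 0 < ‖f z₁ - f p‖ := norm_pos_iff.2 (sub_ne_zero.2 hne)
    have hlim : Tendsto (fun n : ℕ => 4 * M * (2 / 3 : ℝ) ^ n) atTop (𝓝 (4 * M * 0)) :=
      (tendsto_pow_atTop_nhds_zero_of_lt_one (by norm_num) (by norm_num)).const_mul _
    rw [mul_zero] at hlim
    obtain ⟨N, hN⟩ := eventually_atTop.1 (hlim.eventually (gt_mem_nhds hpos))
    refine ⟨ball p (r / 4), mem_nhdsWithin_of_mem_nhds (ball_mem_nhds p (by positivity)), N,
      fun c Z hZ => ?_⟩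
    by_contra! hcard
    obtain ⟨z₂, hz₂⟩ : Z.Nonempty := Finset.card_pos.1 (by omega)
    have hsub : ball p (r / 4) ⊆ closedBall p r :=
      ball_subset_closedBall.trans (closedBall_subset_closedBall (by linarith))
    have hc : ‖c‖ ≤ M := by
      rw [← (hZ z₂ hz₂).2]
      exact hM _ (hsub (hZ z₂ hz₂).1)
    have key : ∀ z ∈ ball p (r / 4), ‖f z - c‖ ≤ 2 * M * (2 / 3) ^ Z.card := fun z hz =>
      norm_le_of_zeros hΩ hr hrΩ Z (fun z hz => (hZ z hz).1) (hf.sub_const c)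
        (fun w hw => (norm_sub_le _ _).trans (by linarith [hM w (sphere_subset_closedBall hw)]))
        (fun w hw => sub_eq_zero.2 (hZ w hw).2) hz
    have h1 := key z₁ hz₁
    have h2 := key p (mem_ball_self (by positivity))
    have h3 := hN Z.card hcard.le
    have h4 : ‖f z₁ - f p‖ ≤ ‖f z₁ - c‖ + ‖f p - c‖ := by
      rw [← dist_eq_norm, ← dist_eq_norm, ← dist_eq_norm]
      exact dist_triangle_right _ _ _
    linarith

/-- Zeros of `f - b` are isolated, so small circles avoid them; the same circle serves all nearby
points and values, and compactness makes `c` uniform. On these circles the remainder of the partial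
fractions will be estimated. -/
theorem exists_sphere_le_norm_sub (hΩ : IsOpen Ω) (hf : AnalyticOnNhd ℂ f Ω)
    (hnl : ∀ p ∈ Ω, ∀ c, ¬ ∀ᶠ z in 𝓝 p, f z = c) {L B : Set ℂ} (hL : IsCompact L) (hLΩ : L ⊆ Ω)
    (hB : IsCompact B) :
    ∃ c > 0, ∀ x ∈ L ×ˢ B, ∃ p ρ, 0 < ρ ∧ x.1 ∈ ball p ρ ∧ closedBall p ρ ⊆ Ω ∧
      ∀ z ∈ sphere p ρ, c ≤ ‖f z - x.2‖ := by
  refine (hL.prod hB).induction_on (p := fun S => ∃ c > 0, ∀ x ∈ S, ∃ p ρ, 0 < ρ ∧ x.1 ∈ ball p ρ ∧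
    closedBall p ρ ⊆ Ω ∧ ∀ z ∈ sphere p ρ, c ≤ ‖f z - x.2‖) ?_ ?_ ?_ ?_
  · exact ⟨1, one_pos, fun x hx => hx.elim⟩
  · rintro S S' hS ⟨c, hc, h⟩
    exact ⟨c, hc, fun x hx => h x (hS hx)⟩
  · rintro S S' ⟨c, hc, h⟩ ⟨c', hc', h'⟩
    refine ⟨min c c', lt_min hc hc', fun x hx => ?_⟩
    rcases hx with hx | hx
    · obtain ⟨p, ρ, h1, h2, h3, h4⟩ := h x hx
      exact ⟨p, ρ, h1, h2, h3, fun z hz => (min_le_left _ _).trans (h4 z hz)⟩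
    · obtain ⟨p, ρ, h1, h2, h3, h4⟩ := h' x hx
      exact ⟨p, ρ, h1, h2, h3, fun z hz => (min_le_right _ _).trans (h4 z hz)⟩
  · rintro ⟨p, b⟩ ⟨hp, hb⟩
    have hpΩ := hLΩ hp
    have hne : ∀ᶠ z in 𝓝[≠] p, f z - b ≠ 0 := by
      refine (((hf p hpΩ).sub analyticAt_const).eventually_eq_zero_or_eventually_ne_zero).resolve_left
        fun h => hnl p hpΩ b ?_
      filter_upwards [h] with z hz using sub_eq_zero.1 hz
    obtain ⟨ρ, hρ, hρs⟩ := nhds_basis_closedBall.mem_iff.1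
      (inter_mem (hΩ.mem_nhds hpΩ) (eventually_nhdsWithin_iff.1 hne))
    have hcont : ContinuousOn (fun z => ‖f z - b‖) (sphere p ρ) :=
      ((hf.continuousOn.mono fun z hz => (hρs (sphere_subset_closedBall hz)).1).sub
        continuousOn_const).norm
    obtain ⟨z₀, hz₀, hmin⟩ := (isCompact_sphere p ρ).exists_isMinOn
      (NormedSpace.sphere_nonempty.2 hρ.le) hcont
    have hpos : 0 < ‖f z₀ - b‖ := norm_pos_iff.2
      ((hρs (sphere_subset_closedBall hz₀)).2 (ne_of_mem_sphere hz₀ hρ.ne'))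
    refine ⟨ball p ρ ×ˢ ball b (‖f z₀ - b‖ / 2), mem_nhdsWithin_of_mem_nhds
      (prod_mem_nhds (ball_mem_nhds p hρ) (ball_mem_nhds b (by positivity))), ‖f z₀ - b‖ / 2,
      by positivity, ?_⟩
    rintro ⟨p', b'⟩ ⟨hp', hb'⟩
    refine ⟨p, ρ, hρ, hp', fun z hz => (hρs hz).1, fun z hz => ?_⟩
    have h1 : ‖f z₀ - b‖ ≤ ‖f z - b‖ := hmin hz
    have h2 : ‖f z - b‖ ≤ ‖f z - b'‖ + ‖b' - b‖ := norm_sub_le_norm_sub_add_norm_sub _ _ _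
    rw [mem_ball, dist_eq_norm] at hb'
    simp only at hb' ⊢
    linarith

/-- Write `f'(z) = (z - w₀)^n g(z)` with `g(w₀) ≠ 0`, and let `w` be a point of `K` nearest to `z`.
Since `w₀ ∈ K`, `|z - w| ≤ |z - w₀|`; so on the disc about `z` of radius `|z - w|` the distance to
`w₀` at most doubles, and `|f'|` is at most a constant times `|f'(z)|`. The mean value inequality
between `z` and `w` concludes. -/
theorem exists_infDist_image_le_nhds (hΩ : IsOpen Ω) (hf : AnalyticOnNhd ℂ f Ω)
    (hnl : ∀ p ∈ Ω, ∀ c, ¬ ∀ᶠ z in 𝓝 p, f z = c) {K : Set ℂ} (hK : IsCompact K) (hKΩ : K ⊆ Ω)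
    {w₀ : ℂ} (hw₀ : w₀ ∈ K) : ∃ C, 0 ≤ C ∧ ∀ᶠ z in 𝓝 w₀,
      infDist (f z) (f '' K) ≤ C * ‖deriv f z‖ * infDist z K := by
  have hw₀Ω := hKΩ hw₀
  have hf' : AnalyticAt ℂ (deriv f) w₀ := (hf w₀ hw₀Ω).deriv
  have hne : ¬ ∀ᶠ z in 𝓝 w₀, deriv f z = 0 := by
    intro h
    obtain ⟨r, hr, hrs⟩ := nhds_basis_ball.mem_iff.1 (inter_mem (hΩ.mem_nhds hw₀Ω) h)
    refine hnl w₀ hw₀Ω (f w₀) (eventually_of_mem (ball_mem_nhds w₀ hr) fun z hz => ?_)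
    exact isOpen_ball.is_const_of_deriv_eq_zero (convex_ball w₀ r).isPreconnected
      (fun z hz => (hf z (hrs hz).1).differentiableAt.differentiableWithinAt)
      (fun z hz => (hrs hz).2) hz (mem_ball_self hr)
  obtain ⟨n, g, hg, hg0, hfg⟩ := hf'.exists_eventuallyEq_pow_smul_nonzero_iff.2 hne
  have hgpos : 0 < ‖g w₀‖ := norm_pos_iff.2 hg0
  have hgl : ∀ᶠ z in 𝓝 w₀, ‖g w₀‖ / 2 < ‖g z‖ :=
    hg.continuousAt.norm.eventually (lt_mem_nhds (by linarith))
  have hgu : ∀ᶠ z in 𝓝 w₀, ‖g z‖ < 2 * ‖g w₀‖ :=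
    hg.continuousAt.norm.eventually (gt_mem_nhds (by linarith))
  obtain ⟨r, hr, hrs⟩ := nhds_basis_ball.mem_iff.1
    (inter_mem (hΩ.mem_nhds hw₀Ω) (inter_mem hfg (inter_mem hgl hgu)))
  -- `2 ^ n` comes from the doubled distance to `w₀`, and `4` from `|g|` lying between `|g(w₀)|/2`
  -- and `2|g(w₀)|`. The radius `r/2` keeps the disc about `z` inside `ball w₀ r`.
  refine ⟨4 * 2 ^ n, by positivity, eventually_of_mem (ball_mem_nhds w₀ (half_pos hr)) fun z hz => ?_⟩
  obtain ⟨w, hwK, hw⟩ := hK.exists_infDist_eq_dist ⟨w₀, hw₀⟩ z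
  have hwd : dist z w ≤ dist z w₀ := hw ▸ infDist_le_dist_of_mem hw₀
  rw [mem_ball] at hz
  have hdist : ∀ ζ ∈ closedBall z (dist z w), dist ζ w₀ ≤ 2 * dist z w₀ := fun ζ hζ => by
    have := dist_triangle ζ z w₀
    rw [mem_closedBall] at hζ
    linarith
  have hmem : ∀ ζ ∈ closedBall z (dist z w), ζ ∈ ball w₀ r := fun ζ hζ => by
    rw [mem_ball]; linarith [hdist ζ hζ]
  have hzm : z ∈ closedBall z (dist z w) := mem_closedBall_self dist_nonneg
  have hz2 : ‖z - w₀‖ ^ n * (‖g w₀‖ / 2) ≤ ‖deriv f z‖ := by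
    obtain ⟨-, h1, h2, -⟩ := hrs (hmem z hzm)
    have h1' : deriv f z = (z - w₀) ^ n • g z := h1
    rw [h1', norm_smul, norm_pow]
    gcongr
    exact le_of_lt h2
  have hbound : ∀ ζ ∈ closedBall z (dist z w), ‖deriv f ζ‖ ≤ 4 * 2 ^ n * ‖deriv f z‖ := by
    intro ζ hζ
    obtain ⟨-, h1, -, h2⟩ := hrs (hmem ζ hζ)
    have h1' : deriv f ζ = (ζ - w₀) ^ n • g ζ := h1
    have h2' : ‖g ζ‖ < 2 * ‖g w₀‖ := h2
    have h3 := hdist ζ hζ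
    rw [dist_eq_norm, dist_eq_norm] at h3
    rw [h1', norm_smul, norm_pow]
    calc ‖ζ - w₀‖ ^ n * ‖g ζ‖ ≤ (2 * ‖z - w₀‖) ^ n * (2 * ‖g w₀‖) := by gcongr
      _ = 4 * 2 ^ n * (‖z - w₀‖ ^ n * (‖g w₀‖ / 2)) := by rw [mul_pow]; ring
      _ ≤ _ := by gcongr
  have hwm : w ∈ closedBall z (dist z w) := by rw [mem_closedBall, dist_comm]
  have h := (convex_closedBall z (dist z w)).norm_image_sub_le_of_norm_deriv_le
    (fun ζ hζ => (hf ζ (hrs (hmem ζ hζ)).1).differentiableAt) hbound hwm hzm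
  rw [hw, dist_eq_norm]
  exact (infDist_le_dist_of_mem (mem_image_of_mem f hwK)).trans (by rwa [dist_eq_norm])

theorem exists_infDist_image_le (hΩ : IsOpen Ω) (hf : AnalyticOnNhd ℂ f Ω)
    (hnl : ∀ p ∈ Ω, ∀ c, ¬ ∀ᶠ z in 𝓝 p, f z = c) {K : Set ℂ} (hK : IsCompact K) (hKΩ : K ⊆ Ω) :
    ∃ V, IsOpen V ∧ K ⊆ V ∧ ∃ C, 0 ≤ C ∧ ∀ z ∈ V,
      infDist (f z) (f '' K) ≤ C * ‖deriv f z‖ * infDist z K := by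
  refine hK.induction_on (p := fun S => ∃ V, IsOpen V ∧ S ⊆ V ∧ ∃ C, 0 ≤ C ∧ ∀ z ∈ V,
      infDist (f z) (f '' K) ≤ C * ‖deriv f z‖ * infDist z K) ?_ ?_ ?_ ?_
  · exact ⟨∅, isOpen_empty, subset_rfl, 0, le_rfl, fun z hz => hz.elim⟩
  · rintro S S' hS ⟨V, hV, hSV, h⟩
    exact ⟨V, hV, hS.trans hSV, h⟩
  · rintro S S' ⟨V, hV, hSV, C, hC, h⟩ ⟨V', hV', hSV', C', hC', h'⟩
    refine ⟨V ∪ V', hV.union hV', union_subset_union hSV hSV', max C C', hC.trans (le_max_left _ _),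
      fun z hz => ?_⟩
    have hd : 0 ≤ infDist z K := infDist_nonneg
    rcases hz with hz | hz
    · refine (h z hz).trans ?_
      gcongr
      exact le_max_left _ _
    · refine (h' z hz).trans ?_
      gcongr
      exact le_max_right _ _
  · intro w₀ hw₀
    obtain ⟨C, hC, h⟩ := exists_infDist_image_le_nhds hΩ hf hnl hK hKΩ hw₀
    obtain ⟨V, hVs, hV, hwV⟩ := _root_.mem_nhds_iff.1 h
    exact ⟨V, mem_nhdsWithin_of_mem_nhds (hV.mem_nhds hwV), V, hV, subset_rfl, C, hC,
      fun z hz => hVs hz⟩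

end FunctionTheory

/-! ### Partial fractions of `1/(f - b)`, uniformly in `b` -/

section PartialFractions

section linearity

variable {A : Type*} [NormedRing A] [NormedAlgebra ℂ A] {T : A} {U : Set ℂ}
  {χ g h : ℂ → ℂ}

theorem areaCalculus_congr (hχ : tsupport χ ⊆ U) (hgh : EqOn g h U) :
    areaCalculus T χ g = areaCalculus T χ h := by
  rw [areaCalculus, areaCalculus]
  congr 1
  refine integral_congr_ae (Eventually.of_forall fun w => ?_)
  beta_reduce
  by_cases hw : w ∈ tsupport χ
  · rw [hgh (hχ hw)]
  · simp [dbar_eq_zero_of_notMem_tsupport hw]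

theorem areaCalculus_const_mul (c : ℂ) :
    areaCalculus T χ (fun z => c * g z) = c • areaCalculus T χ g := by
  have h : ∀ w, dbar χ w • (c * g w) • resolvent T w =
      c • (dbar χ w • g w • resolvent T w) := fun w => by rw [mul_smul, smul_comm]
  simp only [areaCalculus, h]
  rw [integral_smul, smul_comm]

variable [CompleteSpace A]

theorem areaCalculus_add (hχ : IsCutoff χ (spectrum ℂ T) U) (hg : DifferentiableOn ℂ g U)
    (hh : DifferentiableOn ℂ h U) :
    areaCalculus T χ (fun z => g z + h z) = areaCalculus T χ g + areaCalculus T χ h := by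
  simp only [areaCalculus, add_smul, smul_add]
  rw [integral_add (integrable_areaCalculus hχ hg) (integrable_areaCalculus hχ hh), smul_add]

theorem areaCalculus_sum {ι : Type*} (hχ : IsCutoff χ (spectrum ℂ T) U) (s : Finset ι)
    {G : ι → ℂ → ℂ} (hG : ∀ i ∈ s, DifferentiableOn ℂ (G i) U) :
    areaCalculus T χ (fun z => ∑ i ∈ s, G i z) = ∑ i ∈ s, areaCalculus T χ (G i) := by
  simp only [areaCalculus, Finset.sum_smul, Finset.smul_sum]
  rw [integral_finsetSum _ fun i hi => integrable_areaCalculus hχ (hG i hi), Finset.smul_sum]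

/-- The factor of `B` depends only on `T` and `χ`, which makes the bound uniform over families of
`g`. -/
theorem norm_areaCalculus_le (hχ : IsCutoff χ (spectrum ℂ T) U) {B : ℝ}
    (hB : ∀ z ∈ tsupport (dbar χ), ‖g z‖ ≤ B) :
    ‖areaCalculus T χ g‖ ≤ (Real.pi⁻¹ * ∫ w, ‖dbar χ w • resolvent T w‖) * B := by
  have hint : Integrable fun w => dbar χ w • resolvent T w :=
    hχ.integrable_dbar_smul ((differentiableOn_resolvent T).continuousOn.mono fun _ h => h.2)
  rw [areaCalculus, norm_smul, mul_assoc]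
  have : ‖-(Real.pi : ℂ)⁻¹‖ = Real.pi⁻¹ := by
    rw [norm_neg, norm_inv, Complex.norm_real, Real.norm_of_nonneg Real.pi_pos.le]
  rw [this, ← integral_mul_const]
  refine mul_le_mul_of_nonneg_left ?_ (by positivity)
  refine norm_integral_le_of_norm_le (hint.norm.mul_const B) (Eventually.of_forall fun w => ?_)
  by_cases hw : w ∈ tsupport (dbar χ)
  · rw [smul_comm, norm_smul, mul_comm]
    exact mul_le_mul_of_nonneg_left (hB w hw) (norm_nonneg _)
  · simp [image_eq_zero_of_notMem_tsupport hw]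

end linearity

variable {f : ℂ → ℂ} {Ω : Set ℂ}

/-- Partial fractions of `1 / (f - b)` near `K`, with bounds that are uniform in `b`: the poles are
simple, their number is bounded, and the holomorphic remainder is `O(dist(b, f(K))⁻¹)`. -/
theorem exists_partial_fractions (hΩ : IsOpen Ω) (hf : AnalyticOnNhd ℂ f Ω)
    (hnl : ∀ p ∈ Ω, ∀ c, ¬ ∀ᶠ z in 𝓝 p, f z = c) {K W : Set ℂ} (hK : IsCompact K)
    (hKne : K.Nonempty) (hKΩ : K ⊆ Ω) (hW : IsOpen W) (hKW : K ⊆ W) (R₀ : ℝ) :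
    ∃ V, IsOpen V ∧ K ⊆ V ∧ V ⊆ Ω ∧ ∀ L, IsCompact L → L ⊆ V → ∃ (N : ℕ) (C : ℝ), 0 < C ∧
      ∀ b ∈ closedBall (0 : ℂ) R₀ \ f '' K, ∃ Z : Finset ℂ, Z.card ≤ N ∧
        (∀ ζ ∈ Z, ζ ∈ W \ K ∧ f ζ = b ∧ deriv f ζ ≠ 0 ∧ infDist b (f '' K) ≤ C * infDist ζ K ∧
          infDist b (f '' K) ≤ C * ‖deriv f ζ‖ * infDist ζ K) ∧
        ∃ q, DifferentiableOn ℂ q V ∧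
          (∀ z ∈ V, f z ≠ b →
            (f z - b)⁻¹ = q z + ∑ ζ ∈ Z, (deriv f ζ)⁻¹ * (z - ζ)⁻¹) ∧
          ∀ z ∈ L, ‖q z‖ ≤ C / infDist b (f '' K) := by
  obtain ⟨V₀, hV₀, hKV₀, C₁, hC₁, hkey⟩ := exists_infDist_image_le hΩ hf hnl hK hKΩ
  obtain ⟨δ, hδ, hδs⟩ := hK.exists_cthickening_subset_open ((hΩ.inter hW).inter hV₀)
    (subset_inter (subset_inter hKΩ hKW) hKV₀)
  set K₂ := cthickening δ K with hK₂
  have hK₂c : IsCompact K₂ := hK.cthickening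
  have hK₂Ω : K₂ ⊆ Ω := fun z hz => (hδs hz).1.1
  have hVK₂ : thickening δ K ⊆ K₂ := thickening_subset_cthickening δ K
  have hVo : IsOpen (thickening δ K) := isOpen_thickening
  have hfd : DifferentiableOn ℂ f Ω := hf.differentiableOn
  refine ⟨thickening δ K, hVo, self_subset_thickening hδ K, hVK₂.trans hK₂Ω,
    fun L hL hLV => ?_⟩
  set V := thickening δ K
  obtain ⟨N, hN⟩ := exists_card_le_of_isCompact hΩ hfd hnl hK₂c hK₂Ω
  obtain ⟨c, hc, hsph⟩ := exists_sphere_le_norm_sub hVo (hf.mono (hVK₂.trans hK₂Ω))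
    (fun p hp => hnl p (hK₂Ω (hVK₂ hp))) hL hLV (isCompact_closedBall (0 : ℂ) R₀)
  -- A point of `K₂` where `|f - b| ≥ c` is at distance at least `η` from every root of `f = b` in
  -- `K₂`.
  obtain ⟨η, hη, hunif⟩ := uniformContinuousOn_iff.1
    (hK₂c.uniformContinuousOn_of_continuous (hfd.continuousOn.mono hK₂Ω)) c hc
  obtain ⟨M₁, hM₁⟩ := hK₂c.exists_bound_of_continuousOn (hf.deriv.continuousOn.mono hK₂Ω)
  obtain ⟨M₂, hM₂⟩ := hK₂c.exists_bound_of_continuousOn (continuous_infDist_pt K).continuousOn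
  obtain ⟨k₀, hk₀⟩ := hKne
  have hM₁0 : 0 ≤ M₁ := (norm_nonneg _).trans (hM₁ k₀ (self_subset_cthickening K hk₀))
  have hM₂0 : 0 ≤ M₂ := (norm_nonneg _).trans (hM₂ k₀ (self_subset_cthickening K hk₀))
  have hfKc : IsClosed (f '' K) := (hK.image_of_continuousOn (hfd.continuousOn.mono hKΩ)).isClosed
  have hfKne : (f '' K).Nonempty := ⟨f k₀, mem_image_of_mem f hk₀⟩
  set B₀ := |R₀| + ‖f k₀‖
  set C₂ := B₀ / c + N * (C₁ * M₂ / η) with hC₂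
  have hC₂0 : 0 ≤ C₂ := by positivity
  set C := C₁ + C₁ * M₁ + C₂ + 1 with hCdef
  have hCpos : 0 < C := by positivity
  have hC1 : C₁ ≤ C := by
    have : 0 ≤ C₁ * M₁ := by positivity
    linarith
  have hC2 : C₁ * M₁ ≤ C := by linarith
  have hC3 : C₂ ≤ C := by
    have : 0 ≤ C₁ * M₁ := by positivity
    linarith
  refine ⟨N, C, hCpos, fun b hb => ?_⟩
  obtain ⟨hbR, hbK⟩ := hb
  set D := infDist b (f '' K) with hD
  have hDpos : 0 < D := (hfKc.notMem_iff_infDist_pos hfKne).1 hbK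
  have hDB : D ≤ B₀ := by
    refine (infDist_le_dist_of_mem (mem_image_of_mem f hk₀)).trans ((dist_le_norm_add_norm _ _).trans ?_)
    rw [mem_closedBall_zero_iff] at hbR
    linarith [le_abs_self R₀]
  have hfin : {z | z ∈ K₂ ∧ f z = b}.Finite := by
    by_contra hinf
    obtain ⟨t, hts, htc⟩ := Set.Infinite.exists_subset_card_eq hinf (N + 1)
    have := hN b t fun z hz => hts hz
    omega
  -- All roots in the compact `K₂` are taken, including any outside the open `V`; their terms are
  -- holomorphic on `V` and harmless.
  set Z := hfin.toFinset with hZdef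
  have hZ : ∀ {z}, z ∈ Z ↔ z ∈ K₂ ∧ f z = b := by simp [hZdef]
  have hZD : ∀ ζ ∈ Z, D ≤ C₁ * ‖deriv f ζ‖ * infDist ζ K := fun ζ hζ => by
    have := hkey ζ (hδs (hZ.1 hζ).1).2
    rwa [(hZ.1 hζ).2] at this
  have hZd : ∀ ζ ∈ Z, deriv f ζ ≠ 0 := fun ζ hζ h0 => by
    have := hZD ζ hζ
    rw [h0] at this
    simp at this
    linarith
  refine ⟨Z, hN b Z fun z hz => hZ.1 hz, fun ζ hζ => ⟨⟨(hδs (hZ.1 hζ).1).1.2, fun h => hbK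
    ⟨ζ, h, (hZ.1 hζ).2⟩⟩, (hZ.1 hζ).2, hZd ζ hζ, ?_, ?_⟩, ?_⟩
  · refine (hZD ζ hζ).trans ?_
    have := hM₁ ζ (hZ.1 hζ).1
    have h0 : 0 ≤ infDist ζ K := infDist_nonneg
    calc C₁ * ‖deriv f ζ‖ * infDist ζ K ≤ C₁ * M₁ * infDist ζ K := by gcongr
      _ ≤ _ := by gcongr
  · refine (hZD ζ hζ).trans ?_
    have h0 : 0 ≤ infDist ζ K := infDist_nonneg
    gcongr
  have hds : ∀ ζ ∈ Z, DifferentiableOn ℂ (dslope f ζ) V := fun ζ hζ =>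
    ((differentiableOn_dslope (hΩ.mem_nhds (hK₂Ω (hZ.1 hζ).1))).2 hfd).mono (hVK₂.trans hK₂Ω)
  -- The numerator of `q = g/(f - b)`. It vanishes at each root in `V`, because there exactly one
  -- summand is nonzero, and it equals `1`.
  have hg : DifferentiableOn ℂ (fun z => 1 - ∑ ζ ∈ Z, (deriv f ζ)⁻¹ * dslope f ζ z) V :=
    (differentiableOn_const 1).sub
      (DifferentiableOn.fun_sum fun ζ hζ => (hds ζ hζ).const_mul _)
  obtain ⟨q, hq, hqe⟩ := exists_differentiableOn_eq_mul hVo (F := fun z => f z - b)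
    ((hfd.mono (hVK₂.trans hK₂Ω)).sub_const b) hg (by
      intro z hz h0
      have hzZ : z ∈ Z := hZ.2 ⟨hVK₂ hz, sub_eq_zero.1 h0⟩
      refine ⟨?_, by rw [deriv_sub_const]; exact hZd z hzZ⟩
      rw [Finset.sum_eq_single z, dslope_same, inv_mul_cancel₀ (hZd z hzZ), sub_self]
      · intro ζ hζ hne
        rw [dslope_of_ne _ hne.symm, slope_def_field, (hZ.1 hζ).2, (hZ.1 hzZ).2]
        simp
      · exact fun h => absurd hzZ h)
  have hpf : ∀ z ∈ V, f z ≠ b → (f z - b)⁻¹ = q z + ∑ ζ ∈ Z, (deriv f ζ)⁻¹ * (z - ζ)⁻¹ := by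
    intro z hz hzb
    have hzb' : f z - b ≠ 0 := sub_ne_zero.2 hzb
    have h1 : ∑ ζ ∈ Z, (deriv f ζ)⁻¹ * dslope f ζ z =
        (∑ ζ ∈ Z, (deriv f ζ)⁻¹ * (z - ζ)⁻¹) * (f z - b) := by
      rw [Finset.sum_mul]
      refine Finset.sum_congr rfl fun ζ hζ => ?_
      have hne : z ≠ ζ := fun e => hzb (e ▸ (hZ.1 hζ).2)
      rw [dslope_of_ne _ hne, slope_def_field, (hZ.1 hζ).2]
      ring
    have h2 := hqe z hz
    rw [h1] at h2
    refine inv_eq_of_mul_eq_one_left ?_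
    linear_combination -h2
  refine ⟨q, hq, hpf, fun z hz => ?_⟩
  obtain ⟨p, ρ, hρ, hzp, hpV, hcp⟩ := hsph (z, b) ⟨hz, hbR⟩
  -- Maximum principle: `q` is estimated on a circle around `z` where `|f - b| ≥ c`, with the roots
  -- at distance at least `η`.
  refine (norm_le_of_forall_mem_frontier_norm_le (isBounded_ball (x := p) (r := ρ))
    (hq.diffContOnCl_ball hpV) (C := C₂ / D) ?_ (subset_closure hzp)).trans (by gcongr)
  rw [frontier_ball _ hρ.ne']
  intro w hw
  have hwV : w ∈ V := hpV (sphere_subset_closedBall hw)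
  have hcw : c ≤ ‖f w - b‖ := hcp w hw
  have hwb : f w ≠ b := fun e => by
    rw [e, sub_self, norm_zero] at hcw
    linarith
  have hqw : q w = (f w - b)⁻¹ - ∑ ζ ∈ Z, (deriv f ζ)⁻¹ * (w - ζ)⁻¹ := by
    rw [hpf w hwV hwb]; ring
  have h1 : ‖(f w - b)⁻¹‖ ≤ B₀ / c / D := by
    calc ‖(f w - b)⁻¹‖ ≤ c⁻¹ := by rw [norm_inv]; gcongr
      _ = D / c / D := by field_simp
      _ ≤ B₀ / c / D := by gcongr
  have h2 : ‖∑ ζ ∈ Z, (deriv f ζ)⁻¹ * (w - ζ)⁻¹‖ ≤ N * (C₁ * M₂ / η / D) := by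
    refine (norm_sum_le_of_le Z (n := fun _ => C₁ * M₂ / η / D) fun ζ hζ => ?_).trans ?_
    · have h3 : η ≤ ‖w - ζ‖ := by
        rw [← dist_eq_norm]
        by_contra! hlt
        have := hunif w (hVK₂ hwV) ζ (hZ.1 hζ).1 hlt
        rw [dist_eq_norm, (hZ.1 hζ).2] at this
        linarith
      have h4 : 0 < ‖deriv f ζ‖ := norm_pos_iff.2 (hZd ζ hζ)
      have h5 : D ≤ C₁ * ‖deriv f ζ‖ * M₂ := by
        refine (hZD ζ hζ).trans ?_
        have := (le_abs_self _).trans (hM₂ ζ (hZ.1 hζ).1)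
        gcongr
      have h6 : ‖deriv f ζ‖⁻¹ ≤ C₁ * M₂ / D := by
        rw [inv_le_iff_one_le_mul₀ h4, div_mul_eq_mul_div, one_le_div hDpos]
        linarith
      rw [norm_mul, norm_inv, norm_inv]
      calc ‖deriv f ζ‖⁻¹ * ‖w - ζ‖⁻¹ ≤ C₁ * M₂ / D * η⁻¹ := by gcongr
        _ = _ := by ring
    · rw [Finset.sum_const, nsmul_eq_mul]
      have : (Z.card : ℝ) ≤ N := by exact_mod_cast hN b Z fun z hz => hZ.1 hz
      gcongr
  rw [hqw]
  refine (norm_sub_le _ _).trans ((add_le_add h1 h2).trans_eq ?_)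
  rw [hC₂]; ring

end PartialFractions

/-! ### Inverses in the calculus -/

section inverse

variable {A : Type*} [NormedRing A] [NormedAlgebra ℂ A] [CompleteSpace A] {T : A} {Ω U : Set ℂ}
  {χ₀ χ f : ℂ → ℂ}

/-- The calculus inverts `f(T) - b` if `f` omits the value `b` on the support of a cutoff. -/
theorem areaCalculus_sub_mul_inv (hΩ : IsOpen Ω) (hf : DifferentiableOn ℂ f Ω)
    (hχ₀ : IsCutoff χ₀ (spectrum ℂ T) Ω) (hU : IsOpen U) (hUΩ : U ⊆ Ω)
    (hχ : IsCutoff χ (spectrum ℂ T) U) {b : ℂ} (hb : ∀ z ∈ U, f z ≠ b) :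
    (areaCalculus T χ₀ f - algebraMap ℂ A b) * areaCalculus T χ (fun z => (f z - b)⁻¹) = 1 ∧
    areaCalculus T χ (fun z => (f z - b)⁻¹) * (areaCalculus T χ₀ f - algebraMap ℂ A b) = 1 := by
  have hfU := hf.mono hUΩ
  have hinv : DifferentiableOn ℂ (fun z => (f z - b)⁻¹) U :=
    (hfU.sub_const b).inv fun z hz => sub_ne_zero.2 (hb z hz)
  rw [areaCalculus_eq_of_isCutoff hΩ hχ₀ (hχ.mono hUΩ) hf]
  have h1 : areaCalculus T χ (fun z => f z - b) = areaCalculus T χ f - algebraMap ℂ A b := by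
    have h2 := areaCalculus_add hχ hfU (h := fun _ => -b * 1) (differentiableOn_const _)
    rw [areaCalculus_const_mul, areaCalculus_one hχ] at h2
    simp only [mul_one, ← sub_eq_add_neg] at h2
    rw [h2, neg_smul, ← sub_eq_add_neg, Algebra.algebraMap_eq_smul_one]
  have h3 : EqOn (fun z => (f z - b) * (f z - b)⁻¹) (fun _ => 1) U := fun z hz =>
    mul_inv_cancel₀ (sub_ne_zero.2 (hb z hz))
  have h4 : EqOn (fun z => (f z - b)⁻¹ * (f z - b)) (fun _ => 1) U := fun z hz =>
    inv_mul_cancel₀ (sub_ne_zero.2 (hb z hz))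
  rw [← h1, areaCalculus_mul hU hχ (hfU.sub_const b) hinv, areaCalculus_congr hχ.tsupport_subset h3,
    areaCalculus_mul hU hχ hinv (hfU.sub_const b), areaCalculus_congr hχ.tsupport_subset h4,
    areaCalculus_one hχ]
  exact ⟨rfl, rfl⟩

theorem areaCalculus_inv_sub (hU : IsOpen U) (hχ : IsCutoff χ (spectrum ℂ T) U) {a : ℂ}
    (ha : a ∉ tsupport χ) : areaCalculus T χ (fun z => (z - a)⁻¹) = -resolvent T a := by
  have h := areaCalculus_mul_resolvent hU hχ (differentiableOn_const (1 : ℂ)) ha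
  rw [areaCalculus_one hχ, one_mul] at h
  have h2 : (fun z : ℂ => (z - a)⁻¹) = fun z => -1 * ((a - z)⁻¹ * 1) := by
    funext z
    rw [← neg_sub, inv_neg]
    ring
  rw [h2, areaCalculus_const_mul, ← h, neg_smul, one_smul]

end inverse

/-! ### Resolvent growth of `f(T)` -/

theorem theoremA {X : Type*} [NormedAddCommGroup X] [NormedSpace ℂ X] [CompleteSpace X]
    (T : X →L[ℂ] X) (K : Set ℂ) (s : ℝ) (hs : 1 ≤ s)
    (Ω : Set ℂ) (hΩ : IsOpen Ω) (hKΩ : K ⊆ Ω)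
    (f : ℂ → ℂ) (hf : AnalyticOnNhd ℂ f Ω)
    (hnc : ∀ z ∈ Ω, ¬ ∃ c : ℂ, ∀ w ∈ connectedComponentIn Ω z, f w = c)
    (hT : HasResolventGrowth T K s)
    (Γ : PlaneCycle) (hΓ : Γ.Surrounds (spectrum ℂ T) Ω) :
    HasResolventGrowth (rieszDunford f T Γ) (f '' K) s := by
  obtain ⟨hK, hσK, a, R, C₀, hKR, hgrowth⟩ := hT
  have hfd : DifferentiableOn ℂ f Ω := hf.differentiableOn
  have hnl : ∀ p ∈ Ω, ∀ c, ¬ ∀ᶠ z in 𝓝 p, f z = c := fun p hp c =>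
    not_eventually_eq_const hf hnc hp c
  obtain ⟨χ₀, hχ₀, hfT⟩ := exists_isCutoff_rieszDunford_eq hΩ hfd hΓ
  rw [hfT]
  set Q := areaCalculus T χ₀ f
  have hfK : IsCompact (f '' K) := hK.image_of_continuousOn (hfd.continuousOn.mono hKΩ)
  obtain ⟨R₀, hR₀⟩ := hfK.isBounded.subset_ball 0
  -- For a subset `V` of `Ω` containing `K` and `b ∉ f(K)`, the calculus on `V \ f⁻¹(b)`.
  have hcut : ∀ V, IsOpen V → K ⊆ V → V ⊆ Ω → ∀ b ∉ f '' K, IsOpen (V ∩ f ⁻¹' {b}ᶜ) ∧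
      ∃ χ, IsCutoff χ (spectrum ℂ T) (V ∩ f ⁻¹' {b}ᶜ) := by
    intro V hV hKV hVΩ b hb
    have hU : IsOpen (V ∩ f ⁻¹' {b}ᶜ) :=
      (hfd.continuousOn.mono hVΩ).isOpen_inter_preimage hV isOpen_compl_singleton
    refine ⟨hU, exists_isCutoff (spectrum.isCompact T) hU fun z hz => ⟨hKV (hσK hz), fun h => ?_⟩⟩
    exact hb ⟨z, hσK hz, h⟩
  have hspec : spectrum ℂ Q ⊆ f '' K := by
    intro b hbσ
    by_contra hb
    obtain ⟨hU, χ, hχ⟩ := hcut Ω hΩ hKΩ subset_rfl b hb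
    obtain ⟨h1, h2⟩ := areaCalculus_sub_mul_inv hΩ hfd hχ₀ hU inter_subset_left hχ
      (b := b) fun z hz => hz.2
    refine hbσ (spectrum.mem_resolventSet_of_left_right_inverse
      (b := -areaCalculus T χ (fun z => (f z - b)⁻¹))
      (c := -areaCalculus T χ (fun z => (f z - b)⁻¹)) ?_ ?_)
    · rw [← h1, mul_neg, ← neg_mul, neg_sub]
    · rw [← h2, neg_mul, ← mul_neg, neg_sub]
  refine ⟨hfK, hspec, 0, R₀, ?_⟩
  rcases K.eq_empty_or_nonempty with rfl | hKne
  · have hX : Subsingleton (X →L[ℂ] X) := by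
      by_contra h
      rw [not_subsingleton_iff_nontrivial] at h
      exact ((spectrum.nonempty T).mono hσK).ne_empty rfl
    refine ⟨0, hR₀, fun z _ => ?_⟩
    rw [Subsingleton.elim (resolvent Q z) 0]
    simp
  obtain ⟨V, hV, hKV, hVΩ, hpf⟩ := exists_partial_fractions hΩ hf hnl hK hKne hKΩ
    (isOpen_ball : IsOpen (ball a R)) hKR R₀
  -- This cutoff is chosen before `b`, so the bound for `q(T)` is uniform in `b`.
  obtain ⟨χ₁, hχ₁⟩ := exists_isCutoff (spectrum.isCompact (𝕜 := ℂ) T) hV (hσK.trans hKV)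
  obtain ⟨N, C, hC, hpf⟩ := hpf (tsupport (dbar χ₁)) hχ₁.hasCompactSupport.dbar
    ((tsupport_dbar_subset _).trans hχ₁.tsupport_subset)
  set M := Real.pi⁻¹ * ∫ w, ‖dbar χ₁ w • resolvent T w‖ with hM
  have hM0 : 0 ≤ M := mul_nonneg (by positivity) (integral_nonneg fun _ => norm_nonneg _)
  set B₀ := |R₀| + R₀ with hB₀
  refine ⟨M * C * B₀ ^ (s - 1) + N * (C * |C₀| * C ^ (s - 1)), hR₀, ?_⟩
  rintro b ⟨hbR, hb⟩
  obtain ⟨Z, hZN, hZ, q, hq, hqe, hqL⟩ := hpf b ⟨ball_subset_closedBall hbR, hb⟩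
  set D := infDist b (f '' K) with hD
  have hDpos : 0 < D :=
    (hfK.isClosed.notMem_iff_infDist_pos (hKne.image f)).1 hb
  have hDB : D ≤ B₀ := by
    obtain ⟨k, hk⟩ := hKne
    have h1 := mem_ball_zero_iff.1 (hR₀ (mem_image_of_mem f hk))
    have h2 := mem_ball_zero_iff.1 hbR
    refine (infDist_le_dist_of_mem (mem_image_of_mem f hk)).trans
      ((dist_le_norm_add_norm _ _).trans ?_)
    linarith [le_abs_self R₀]
  obtain ⟨hU, χ, hχ⟩ := hcut V hV hKV hVΩ b hb
  set U := V ∩ f ⁻¹' {b}ᶜ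
  obtain ⟨h1, h2⟩ := areaCalculus_sub_mul_inv hΩ hfd hχ₀ hU (inter_subset_left.trans hVΩ) hχ
      (b := b) fun z hz => hz.2
  have hZU : ∀ ζ ∈ Z, ζ ∉ tsupport χ := fun ζ hζ h => (hχ.tsupport_subset h).2 (hZ ζ hζ).2.1
  have hres : resolvent Q b = -areaCalculus T χ (fun z => (f z - b)⁻¹) := by
    have h3 : (algebraMap ℂ (X →L[ℂ] X) b - Q) * -areaCalculus T χ (fun z => (f z - b)⁻¹) = 1 := by
      rw [← h1, mul_neg, ← neg_mul, neg_sub]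
    rw [← mul_one (resolvent Q b), ← h3, ← mul_assoc,
      resolvent_mul_sub (fun h => hb (hspec h)), one_mul]
  have hdiff : ∀ ζ ∈ Z, DifferentiableOn ℂ (fun z => (deriv f ζ)⁻¹ * (z - ζ)⁻¹) U := fun ζ hζ =>
    ((differentiableOn_id.sub_const ζ).inv fun z hz => sub_ne_zero.2 fun e =>
      hz.2 ((show z = ζ from e) ▸ (hZ ζ hζ).2.1)).const_mul _
  -- The cutoff `χ` avoids the poles and so depends on `b`; since `q` is holomorphic on all of `V`,
  -- its term may be computed with `χ₁` instead.
  have hS : areaCalculus T χ (fun z => (f z - b)⁻¹) =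
      areaCalculus T χ₁ q + ∑ ζ ∈ Z, (deriv f ζ)⁻¹ • -resolvent T ζ := by
    rw [areaCalculus_congr hχ.tsupport_subset (h := fun z => q z + ∑ ζ ∈ Z,
      (deriv f ζ)⁻¹ * (z - ζ)⁻¹) fun z hz => hqe z hz.1 hz.2,
      areaCalculus_add hχ (hq.mono inter_subset_left) (DifferentiableOn.fun_sum hdiff),
      areaCalculus_sum hχ Z hdiff,
      areaCalculus_eq_of_isCutoff hV (hχ.mono inter_subset_left) hχ₁ hq]
    congr 1
    refine Finset.sum_congr rfl fun ζ hζ => ?_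
    rw [areaCalculus_const_mul, areaCalculus_inv_sub hU hχ (hZU ζ hζ)]
  have hinv : D⁻¹ * D ^ (1 - s) = D ^ (-s) := by
    rw [← Real.rpow_neg_one D, ← Real.rpow_add hDpos]
    congr 1; ring
  have hq1 : ‖areaCalculus T χ₁ q‖ ≤ M * C * B₀ ^ (s - 1) * D ^ (-s) := by
    refine (norm_areaCalculus_le hχ₁ hqL).trans ?_
    have h3 : 1 ≤ B₀ ^ (s - 1) * D ^ (1 - s) := by
      rw [show 1 - s = -(s - 1) by ring, Real.rpow_neg hDpos.le, ← div_eq_mul_inv,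
        one_le_div (by positivity)]
      exact Real.rpow_le_rpow hDpos.le hDB (by linarith)
    calc M * (C / D) = M * C * D⁻¹ * 1 := by ring
      _ ≤ M * C * D⁻¹ * (B₀ ^ (s - 1) * D ^ (1 - s)) := by gcongr
      _ = M * C * B₀ ^ (s - 1) * (D⁻¹ * D ^ (1 - s)) := by ring
      _ = _ := by rw [hinv]
  -- The factor `d` gained from `|f'(ζ)|⁻¹ ≤ C d / D` turns `d^(-s)` into `d^(1-s)`; as `1 - s ≤ 0`,
  -- the bound `d ≥ D / C` then replaces `d` by `D`.
  have hterm : ∀ ζ ∈ Z, ‖(deriv f ζ)⁻¹ • -resolvent T ζ‖ ≤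
      C * |C₀| * C ^ (s - 1) * D ^ (-s) := by
    intro ζ hζ
    obtain ⟨⟨hζR, hζK⟩, -, hd, hD1, hD2⟩ := hZ ζ hζ
    set d := infDist ζ K with hdd
    have hdpos : 0 < d := (hK.isClosed.notMem_iff_infDist_pos hKne).1 hζK
    have h3 : ‖resolvent T ζ‖ ≤ |C₀| * d ^ (-s) := (hgrowth ζ ⟨hζR, hζK⟩).trans (by
      gcongr; exact le_abs_self C₀)
    have h4 : 0 < ‖deriv f ζ‖ := norm_pos_iff.2 hd
    have h5 : ‖deriv f ζ‖⁻¹ ≤ C * d / D := by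
      rw [inv_le_iff_one_le_mul₀ h4, div_mul_eq_mul_div, one_le_div hDpos]
      linarith
    have h6 : d * d ^ (-s) = d ^ (1 - s) := by
      rw [sub_eq_add_neg, Real.rpow_add hdpos, Real.rpow_one]
    have h7 : d ^ (1 - s) ≤ C ^ (s - 1) * D ^ (1 - s) := by
      have h8 : D / C ≤ d := by rw [div_le_iff₀ hC]; linarith
      calc d ^ (1 - s) ≤ (D / C) ^ (1 - s) :=
            Real.rpow_le_rpow_of_nonpos (by positivity) h8 (by linarith)
        _ = C ^ (s - 1) * D ^ (1 - s) := by
            rw [Real.div_rpow hDpos.le hC.le, show s - 1 = -(1 - s) by ring, Real.rpow_neg hC.le]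
            ring
    rw [norm_smul, norm_neg, norm_inv]
    calc ‖deriv f ζ‖⁻¹ * ‖resolvent T ζ‖ ≤ C * d / D * (|C₀| * d ^ (-s)) := by gcongr
      _ = C * |C₀| * (d * d ^ (-s)) * D⁻¹ := by ring
      _ ≤ C * |C₀| * (C ^ (s - 1) * D ^ (1 - s)) * D⁻¹ := by rw [h6]; gcongr
      _ = C * |C₀| * C ^ (s - 1) * (D⁻¹ * D ^ (1 - s)) := by ring
      _ = _ := by rw [hinv]
  rw [hres, norm_neg, hS, add_mul]
  refine (norm_add_le _ _).trans (add_le_add hq1 ?_)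
  refine (norm_sum_le_of_le Z hterm).trans ?_
  rw [Finset.sum_const, nsmul_eq_mul, mul_assoc (N : ℝ)]
  gcongr

end
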